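/- Let $E=(E^0,E^1,r,s)$ be a finite directed graph (multiple edges, loops, sinks and sources are allowed). Its vertex matrix $A$ is the $E^0\times E^0$ matrix with entries $A(v,w)=|\{e\in E^1: r(e)=v,\ s(e)=w\}|$, and $\rho(A)$ denotes its spectral radius. A Toeplitz-Cuntz-Krieger $E$-family in a $C^*$-algebra consists of mutually orthogonal projections $P_v$ ($v\in E^0$) and partial isometries $S_e$ ($e\in E^1$) with $S_e^*S_e=P_{s(e)}$ for every $e\in E^1$ and $P_v\ge\sum_{r(e)=v}S_eS_e^*$ for every $v\in E^0$. Let $\mathcal{T}C^*(E)$ be the $C^*$-algebra generated by a universal Toeplitz-Cuntz-Krieger $E$-family $(p,s)$, and let $\alpha:\mathbb{R}\to\operatorname{Aut}\mathcal{T}C^*(E)$ be the dynamics with $\alpha_t(p_v)=p_v$ and $\alpha_t(s_e)=e^{it}s_e$. A KMS$_\beta$ state of $(\mathcal{T}C^*(E),\alpha)$ is a state $\phi$ such that $\phi(ab)=\phi(b\,\alpha_{i\beta}(a))$ for all analytic elements $a,b$, that is, elements whose orbit $t\mapsto\alpha_t(a)$ extends to an entire function $z\mapsto\alpha_z(a)$.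 Let $\beta\in\mathbb{R}$ satisfy $\beta>\ln\rho(A)$ (with $\ln 0=-\infty$). Then $1-e^{-\beta}A$ is invertible, and for each $v\in E^0$ the series \[ y^\beta_v:=\sum_{n=0}^\infty\ \sum_{w\in E^0}e^{-\beta n}A^n(w,v) \] converges. Put \[ \Delta_\beta:=\Big\{\epsilon\in[0,\infty)^{E^0}:\ \sum_{v\in E^0}\epsilon_v\,y^\beta_v=1\Big\}. \] For each $\epsilon\in\Delta_\beta$ there is a KMS$_\beta$ state $\phi_\epsilon$ of $(\mathcal{T}C^*(E),\alpha)$ such that \[ \phi_\epsilon(p_v)=\big((1-e^{-\beta}A)^{-1}\epsilon\big)_v\quad\text{for all } v\in E^0 . \] Both $\Delta_\beta$ and the set of KMS$_\beta$ states of $(\mathcal{T}C^*(E),\alpha)$ are simplices with $|E^0|$ vertices, and the map $\epsilon\mapsto\phi_\epsilon$ is an isomorphism of $\Delta_\beta$ onto the simplex of KMS$_\beta$ states, that is, an affine bijection which is a homeomorphism for the weak* topology on the states. -/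

import Mathlib

open scoped ENNReal ComplexOrder

universe u v

/-- A directed multigraph with vertex set `V`, edge set `Ed`, and range and source maps. -/
structure DirectedGraph (V : Type u) (Ed : Type v) where
  /-- the range of an edge -/
  r : Ed → V
  /-- the source of an edge -/
  s : Ed → V

section

variable {V : Type u} {Ed : Type v} [Fintype Ed] [DecidableEq V]

namespace DirectedGraph

/-- The vertex matrix: `A v w` is the number of edges with range `v` and source `w`. -/
def vertexMatrix (E : DirectedGraph V Ed) : Matrix V V ℕ :=
  fun v w => (Finset.univ.filter fun e => E.r e = v ∧ E.s e = w).card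

/-- The vertex matrix with real entries. -/
def realMatrix (E : DirectedGraph V Ed) : Matrix V V ℝ :=
  E.vertexMatrix.map (Nat.cast : ℕ → ℝ)

/-- The spectral radius of the vertex matrix, viewed as a complex matrix
(it is `0` if there are no vertices). -/
noncomputable def rho [Fintype V] (E : DirectedGraph V Ed) : ℝ≥0∞ :=
  spectralRadius ℂ (E.vertexMatrix.map (Nat.cast : ℕ → ℂ))

end DirectedGraph

/-- A Toeplitz-Cuntz-Krieger `E`-family in a (not necessarily unital) `C*`-algebra `D`. -/
structure TCKFamily (E : DirectedGraph V Ed) (D : Type*) [NonUnitalCStarAlgebra D] where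
  /-- the vertex projections -/
  P : V → D
  /-- the edge partial isometries -/
  S : Ed → D
  isProj : ∀ v, IsStarProjection (P v)
  orthogonal : ∀ v w, v ≠ w → P v * P w = 0
  partialIsometry : ∀ e, S e * star (S e) * S e = S e
  star_S_mul_S : ∀ e, star (S e) * S e = P (E.s e)
  /-- `P v ≥ ∑_{r e = v} S e (S e)*`: the difference is a positive element of `D`. -/
  sum_le : ∀ v, ∃ c : D,
    P v - ∑ e ∈ Finset.univ.filter (fun e => E.r e = v), S e * star (S e) = star c * c

namespace TCKFamily

variable {E : DirectedGraph V Ed} {D : Type*} [NonUnitalCStarAlgebra D]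

theorem norm_P_le (F : TCKFamily E D) (v : V) : ‖F.P v‖ ≤ 1 :=
  IsStarProjection.norm_le _ (F.isProj v)

theorem norm_S_le (F : TCKFamily E D) (e : Ed) : ‖F.S e‖ ≤ 1 := by
  have h : ‖F.S e‖ * ‖F.S e‖ ≤ 1 := by
    rw [← CStarRing.norm_star_mul_self, F.star_S_mul_S]
    exact F.norm_P_le _
  nlinarith [norm_nonneg (F.S e)]

theorem isProj_range (F : TCKFamily E D) (e : Ed) : IsStarProjection (F.S e * star (F.S e)) :=
  ⟨by
    change _ * _ = _
    rw [← mul_assoc, F.partialIsometry], by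
    change star _ = _
    rw [star_mul, star_star]⟩

theorem P_mul_S (F : TCKFamily E D) (e : Ed) : F.P (E.r e) * F.S e = F.S e := by
  let _ := CStarAlgebra.spectralOrder D
  have := CStarAlgebra.spectralOrderedRing D
  have hle : F.S e * star (F.S e) ≤ F.P (E.r e) := by
    obtain ⟨c, hc⟩ := F.sum_le (E.r e)
    have h1 : ∑ f ∈ Finset.univ.filter (fun f => E.r f = E.r e), F.S f * star (F.S f)
        ≤ F.P (E.r e) := sub_nonneg.1 (hc ▸ star_mul_self_nonneg c)
    refine le_trans ?_ h1
    exact Finset.single_le_sum (f := fun f => F.S f * star (F.S f))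
      (fun f _ => mul_star_self_nonneg (F.S f)) (by simp)
  have h2 := ((F.isProj_range e).le_iff_mul_eq_right (F.isProj _)).1 hle
  calc F.P (E.r e) * F.S e = F.P (E.r e) * (F.S e * star (F.S e) * F.S e) := by
        rw [F.partialIsometry]
    _ = F.P (E.r e) * (F.S e * star (F.S e)) * F.S e := by simp only [mul_assoc]
    _ = F.S e := by rw [h2, F.partialIsometry]

theorem range_mul_range (F : TCKFamily E D) {e f : Ed} (hr : E.r e = E.r f) (hef : e ≠ f) :
    (F.S f * star (F.S f)) * (F.S e * star (F.S e)) = 0 := by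
  classical
  let _ := CStarAlgebra.spectralOrder D
  have := CStarAlgebra.spectralOrderedRing D
  set p := F.S e * star (F.S e) with hp
  set q := F.S f * star (F.S f) with hq
  have hpp : IsStarProjection p := F.isProj_range e
  have hqq : IsStarProjection q := F.isProj_range f
  have hle : p + q ≤ F.P (E.r e) := by
    obtain ⟨c, hc⟩ := F.sum_le (E.r e)
    have h1 : ∑ f ∈ Finset.univ.filter (fun f => E.r f = E.r e), F.S f * star (F.S f)
        ≤ F.P (E.r e) := sub_nonneg.1 (hc ▸ star_mul_self_nonneg c)
    refine le_trans ?_ h1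
    rw [hp, hq, ← Finset.sum_pair (f := fun f => F.S f * star (F.S f)) hef]
    refine Finset.sum_le_sum_of_subset_of_nonneg ?_
      (fun f _ _ => mul_star_self_nonneg (F.S f))
    intro g hg
    rcases Finset.mem_insert.1 hg with rfl | hg
    · simp
    · rw [Finset.mem_singleton.1 hg]; simp [hr]
  have h2 := star_left_conjugate_le_conjugate hle p
  have h3 : F.P (E.r e) * p = p := by rw [hp, ← mul_assoc, F.P_mul_S]
  have hps : star p = p := hpp.isSelfAdjoint.star_eq
  have hqs : star q = q := hqq.isSelfAdjoint.star_eq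
  have hpi : p * p = p := hpp.isIdempotentElem.eq
  have hqi : q * q = q := hqq.isIdempotentElem.eq
  rw [mul_assoc _ (F.P (E.r e)), h3, hps, mul_add, add_mul, hpi, hpi] at h2
  have h4 : p * q * p ≤ 0 := by simpa using h2
  have h5 : star (q * p) * (q * p) = p * q * p := by
    rw [star_mul, hps, hqs, mul_assoc p q (q * p), ← mul_assoc q q p, hqi, ← mul_assoc p q p]
  have h6 : star (q * p) * (q * p) = 0 :=
    le_antisymm (h5 ▸ h4) (star_mul_self_nonneg _)
  exact (CStarRing.star_mul_self_eq_zero_iff _).1 h6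

/-- The gap projections are projections. -/
theorem isProj_gap (F : TCKFamily E D) (v : V) : IsStarProjection
    (F.P v - ∑ e ∈ Finset.univ.filter (fun e => E.r e = v), F.S e * star (F.S e)) := by
  classical
  refine IsStarProjection.sub_of_mul_eq_right ⟨?_, ?_⟩ (F.isProj v) ?_
  · change _ * _ = _
    rw [Finset.sum_mul_sum]
    refine Finset.sum_congr rfl fun e he => ?_
    rw [Finset.sum_eq_single e]
    · exact (F.isProj_range e).isIdempotentElem.eq
    · intro f hf hfe
      refine F.range_mul_range ?_ hfe
      rw [(Finset.mem_filter.1 he).2, (Finset.mem_filter.1 hf).2]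
    · exact fun h => absurd he h
  · change star _ = _
    rw [star_sum]
    exact Finset.sum_congr rfl fun e _ => (F.isProj_range e).isSelfAdjoint.star_eq
  · rw [Finset.mul_sum]
    refine Finset.sum_congr rfl fun e he => ?_
    rw [← (Finset.mem_filter.1 he).2, ← mul_assoc, F.P_mul_S]

/-- Multiplying all the partial isometries of a family by a number of modulus one. -/
def rotate (F : TCKFamily E D) (z : Circle) : TCKFamily E D where
  P := F.P
  S := fun e => (z : ℂ) • F.S e
  isProj := F.isProj
  orthogonal := F.orthogonal
  partialIsometry := fun e => by
    have hz : (z : ℂ) * (starRingEnd ℂ) (z : ℂ) = 1 := by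
      rw [Complex.mul_conj, Circle.normSq_coe]; simp
    simp only [star_smul, smul_mul_assoc, mul_smul_comm, smul_smul, F.partialIsometry]
    congr 1
    rw [RCLike.star_def]
    linear_combination (z : ℂ) * hz
  star_S_mul_S := fun e => by
    have hz : (z : ℂ) * (starRingEnd ℂ) (z : ℂ) = 1 := by
      rw [Complex.mul_conj, Circle.normSq_coe]; simp
    rw [star_smul, smul_mul_smul_comm, RCLike.star_def, mul_comm, hz, one_smul, F.star_S_mul_S]
  sum_le := fun v => by
    have hz : (z : ℂ) * (starRingEnd ℂ) (z : ℂ) = 1 := by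
      rw [Complex.mul_conj, Circle.normSq_coe]; simp
    simpa only [star_smul, smul_mul_smul_comm, RCLike.star_def, hz, one_smul] using F.sum_le v

end TCKFamily

/-- A `C*`-algebra together with a Toeplitz-Cuntz-Krieger `E`-family in it. -/
structure TCKRep (E : DirectedGraph V Ed) where
  /-- the `C*`-algebra -/
  carrier : Type (max u v)
  [inst : NonUnitalCStarAlgebra carrier]
  /-- the family -/
  family : TCKFamily E carrier

attribute [instance] TCKRep.inst

namespace Toeplitz

/-- The `C*`-algebra of all bounded functions on the collection of all
Toeplitz-Cuntz-Krieger `E`-families, with values in the algebras of these families. -/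
abbrev Ambient (E : DirectedGraph V Ed) : Type _ :=
  lp (fun i : TCKRep E => i.carrier) ∞

/-- The direct sum of the projections at `v` of all the families. -/
def ambientP (E : DirectedGraph V Ed) (w : V) : Ambient E :=
  ⟨fun i => i.family.P w, memℓp_infty ⟨1, by rintro _ ⟨i, rfl⟩; exact i.family.norm_P_le w⟩⟩

/-- The direct sum of the partial isometries at `e` of all the families. -/
def ambientS (E : DirectedGraph V Ed) (e : Ed) : Ambient E :=
  ⟨fun i => i.family.S e, memℓp_infty ⟨1, by rintro _ ⟨i, rfl⟩; exact i.family.norm_S_le e⟩⟩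

/-- The closed `*`-subalgebra generated by the direct sum of all families. -/
noncomputable def subalgebra (E : DirectedGraph V Ed) : NonUnitalStarSubalgebra ℂ (Ambient E) :=
  (NonUnitalStarAlgebra.adjoin ℂ
    (Set.range (ambientP E) ∪ Set.range (ambientS E))).topologicalClosure

instance isClosed_subalgebra (E : DirectedGraph V Ed) :
    IsClosed (subalgebra E : Set (Ambient E)) :=
  NonUnitalStarSubalgebra.isClosed_topologicalClosure _

end Toeplitz

/-- The Toeplitz algebra of `E`: the `C*`-algebra generated by the universal
Toeplitz-Cuntz-Krieger `E`-family, the direct sum of all families.  (A `C*`-algebra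
generated by a family is separable, so it has an isomorphic copy in every universe; hence it is
enough to let the direct sum run over the families in algebras from one universe.) -/
def ToeplitzAlgebra (E : DirectedGraph V Ed) : Type _ := Toeplitz.subalgebra E

noncomputable instance (E : DirectedGraph V Ed) : NonUnitalCStarAlgebra (ToeplitzAlgebra E) :=
  inferInstanceAs (NonUnitalCStarAlgebra (Toeplitz.subalgebra E))

namespace Toeplitz

variable {E : DirectedGraph V Ed}

/-- The inclusion of the Toeplitz algebra in the algebra of bounded functions. -/
noncomputable def incl (E : DirectedGraph V Ed) : ToeplitzAlgebra E →⋆ₙₐ[ℂ] Ambient E :=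
  NonUnitalStarSubalgebraClass.subtype (subalgebra E)

/-- The coordinate representation of the Toeplitz algebra given by a family. -/
noncomputable def coord (i : TCKRep E) : ToeplitzAlgebra E →⋆ₙₐ[ℂ] i.carrier where
  toFun a := incl E a i
  map_smul' _ _ := rfl
  map_zero' := rfl
  map_add' _ _ := rfl
  map_mul' _ _ := rfl
  map_star' _ := rfl

theorem ext_coord {a b : ToeplitzAlgebra E} (h : ∀ i : TCKRep E, coord i a = coord i b) :
    a = b :=
  Subtype.ext (lp.ext (funext h))

/-- The universal projections. -/
noncomputable def p (E : DirectedGraph V Ed) (w : V) : ToeplitzAlgebra E :=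
  ⟨ambientP E w, subset_closure (NonUnitalStarAlgebra.subset_adjoin ℂ _ (Or.inl ⟨w, rfl⟩))⟩

/-- The universal partial isometries. -/
noncomputable def s (E : DirectedGraph V Ed) (e : Ed) : ToeplitzAlgebra E :=
  ⟨ambientS E e, subset_closure (NonUnitalStarAlgebra.subset_adjoin ℂ _ (Or.inr ⟨e, rfl⟩))⟩

theorem coord_p (i : TCKRep E) (w : V) : coord i (p E w) = i.family.P w := rfl

theorem coord_s (i : TCKRep E) (e : Ed) : coord i (s E e) = i.family.S e := rfl

/-- `(p, s)` is a Toeplitz-Cuntz-Krieger family. -/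
noncomputable def universalFamily (E : DirectedGraph V Ed) : TCKFamily E (ToeplitzAlgebra E) where
  P := p E
  S := s E
  isProj w := ⟨ext_coord fun i => by
      rw [map_mul, coord_p]; exact (i.family.isProj w).isIdempotentElem.eq,
    ext_coord fun i => by
      rw [map_star, coord_p]; exact (i.family.isProj w).isSelfAdjoint.star_eq⟩
  orthogonal v w h := ext_coord fun i => by
    rw [map_mul, coord_p, coord_p, map_zero]; exact i.family.orthogonal v w h
  partialIsometry e := ext_coord fun i => by
    rw [map_mul, map_mul, map_star, coord_s]; exact i.family.partialIsometry e
  star_S_mul_S e := ext_coord fun i => by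
    rw [map_mul, map_star, coord_s, coord_p]; exact i.family.star_S_mul_S e
  sum_le w := ⟨_, ext_coord fun i => by
    rw [map_mul, map_star, map_sub, map_sum]
    simp only [map_mul, map_star, coord_s, coord_p]
    rw [(i.family.isProj_gap w).isSelfAdjoint.star_eq, (i.family.isProj_gap w).isIdempotentElem.eq]⟩

/-- Homomorphisms of the Toeplitz algebra are determined by their values on generators. -/
theorem hom_ext {D : Type*} [NonUnitalCStarAlgebra D] {φ ψ : ToeplitzAlgebra E →⋆ₙₐ[ℂ] D}
    (hp : ∀ w, φ (p E w) = ψ (p E w)) (hs : ∀ e, φ (s E e) = ψ (s E e)) : φ = ψ := by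
  have hφ : Continuous φ :=
    AddMonoidHomClass.continuous_of_bound φ 1
      (by simpa only [one_mul] using NonUnitalStarAlgHom.norm_apply_le φ)
  have hψ : Continuous ψ :=
    AddMonoidHomClass.continuous_of_bound ψ 1
      (by simpa only [one_mul] using NonUnitalStarAlgHom.norm_apply_le ψ)
  have key : ∀ (x : Ambient E) (hx : x ∈ NonUnitalStarAlgebra.adjoin ℂ
      (Set.range (ambientP E) ∪ Set.range (ambientS E))),
      φ ⟨x, subset_closure hx⟩ = ψ ⟨x, subset_closure hx⟩ := by
    intro x hx
    induction hx using NonUnitalStarAlgebra.adjoin_induction with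
    | mem x hx =>
      rcases hx with ⟨w, rfl⟩ | ⟨e, rfl⟩
      · exact hp w
      · exact hs e
    | add x y hx hy h1 h2 =>
      exact (map_add φ ⟨x, subset_closure hx⟩ ⟨y, subset_closure hy⟩).trans
        ((congrArg₂ (· + ·) h1 h2).trans (map_add ψ _ _).symm)
    | zero => exact (map_zero φ).trans (map_zero ψ).symm
    | mul x y hx hy h1 h2 =>
      exact (map_mul φ ⟨x, subset_closure hx⟩ ⟨y, subset_closure hy⟩).trans
        ((congrArg₂ (· * ·) h1 h2).trans (map_mul ψ _ _).symm)
    | smul r x hx h1 =>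
      exact (map_smul φ r ⟨x, subset_closure hx⟩).trans
        ((congrArg (r • ·) h1).trans (map_smul ψ _ _).symm)
    | star x hx h1 =>
      exact (map_star φ ⟨x, subset_closure hx⟩).trans
        ((congrArg star h1).trans (map_star ψ _).symm)
  refine NonUnitalStarAlgHom.ext fun a => ?_
  have hcl : IsClosed {a : ToeplitzAlgebra E | φ a = ψ a} := isClosed_eq hφ hψ
  obtain ⟨x, hx⟩ := a
  obtain ⟨u, hu, hux⟩ := mem_closure_iff_seq_limit.1 hx
  have hlim : Filter.Tendsto (fun n => (⟨u n, subset_closure (hu n)⟩ : ToeplitzAlgebra E))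
      Filter.atTop (nhds ⟨x, hx⟩) := tendsto_subtype_rng.2 hux
  exact hcl.mem_of_tendsto hlim (Filter.Eventually.of_forall fun n => key _ (hu n))

/-- The universal property of the Toeplitz algebra. -/
theorem existsUnique_hom {D : Type (max u v)} [NonUnitalCStarAlgebra D] (F : TCKFamily E D) :
    ∃! π : ToeplitzAlgebra E →⋆ₙₐ[ℂ] D, (∀ w, π (p E w) = F.P w) ∧ ∀ e, π (s E e) = F.S e := by
  refine ⟨coord ⟨D, F⟩, ⟨fun w => rfl, fun e => rfl⟩, fun π h => hom_ext ?_ ?_⟩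
  · exact fun w => h.1 w
  · exact fun e => h.2 e

/-- The action of the circle on bounded functions, by rotating the argument. -/
noncomputable def ambientRotate (z : Circle) : Ambient E →⋆ₙₐ[ℂ] Ambient E where
  toFun f := ⟨fun i => f ⟨i.carrier, i.family.rotate z⟩, memℓp_infty ⟨‖f‖, by
    rintro _ ⟨i, rfl⟩
    exact lp.norm_apply_le_norm ENNReal.top_ne_zero f ⟨i.carrier, i.family.rotate z⟩⟩⟩
  map_smul' _ _ := rfl
  map_zero' := rfl
  map_add' _ _ := rfl
  map_mul' _ _ := rfl
  map_star' _ := rfl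

theorem ambientRotate_mem (z : Circle) (a : ToeplitzAlgebra E) :
    ambientRotate z (incl E a) ∈ subalgebra E := by
  have hc : Continuous (ambientRotate z : Ambient E →⋆ₙₐ[ℂ] Ambient E) :=
    AddMonoidHomClass.continuous_of_bound (ambientRotate z) 1
      (by simpa only [one_mul] using NonUnitalStarAlgHom.norm_apply_le (ambientRotate z))
  have h1 : subalgebra E ≤ (subalgebra E).comap (ambientRotate z) := by
    refine NonUnitalStarSubalgebra.topologicalClosure_minimal _
      (NonUnitalStarAlgebra.adjoin_le ?_) ((isClosed_subalgebra E).preimage hc)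
    rintro _ (⟨w, rfl⟩ | ⟨e, rfl⟩)
    · exact (p E w).2
    · exact SMulMemClass.smul_mem (z : ℂ) (s E e).2
  exact h1 a.2

/-- The endomorphism of the Toeplitz algebra that fixes the `p w` and multiplies
the `s e` by `z`. -/
noncomputable def gaugeHom (E : DirectedGraph V Ed) (z : Circle) :
    ToeplitzAlgebra E →⋆ₙₐ[ℂ] ToeplitzAlgebra E :=
  NonUnitalStarAlgHom.codRestrict ((ambientRotate z).comp (incl E)) (subalgebra E)
    (ambientRotate_mem z)

theorem gaugeHom_p (z : Circle) (w : V) : gaugeHom E z (p E w) = p E w := rfl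

theorem gaugeHom_s (z : Circle) (e : Ed) : gaugeHom E z (s E e) = (z : ℂ) • s E e := rfl

theorem gaugeHom_comp (z w : Circle) (h : z * w = 1) :
    (gaugeHom E z).comp (gaugeHom E w) = NonUnitalStarAlgHom.id ℂ (ToeplitzAlgebra E) := by
  refine hom_ext (fun v => ?_) (fun e => ?_)
  · simp [gaugeHom_p]
  · have h' : (w : ℂ) * (z : ℂ) = 1 := by rw [mul_comm]; exact_mod_cast congrArg Subtype.val h
    simp [gaugeHom_s, smul_smul, h']

/-- The gauge action. -/
noncomputable def gauge (E : DirectedGraph V Ed) (z : Circle) :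
    ToeplitzAlgebra E ≃⋆ₐ[ℂ] ToeplitzAlgebra E :=
  StarAlgEquiv.ofNonUnitalStarAlgHom (gaugeHom E z) (gaugeHom E z⁻¹)
    (gaugeHom_comp _ _ (by simp)) (gaugeHom_comp _ _ (by simp))

theorem gauge_p (z : Circle) (w : V) : gauge E z (p E w) = p E w := rfl

theorem gauge_s (z : Circle) (e : Ed) : gauge E z (s E e) = (z : ℂ) • s E e := rfl

/-- The dynamics `α t = γ (exp (i t))`. -/
noncomputable def dynamics (E : DirectedGraph V Ed) (t : ℝ) :
    ToeplitzAlgebra E ≃⋆ₐ[ℂ] ToeplitzAlgebra E :=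
  gauge E (Circle.exp t)

end Toeplitz

end

section

variable {B : Type*} [NonUnitalCStarAlgebra B]

/-- `φ` is a state: a positive linear functional of norm one. -/
def IsState (φ : WeakDual ℂ B) : Prop :=
  (∀ b, 0 ≤ φ (star b * b)) ∧ ‖WeakDual.toStrongDual φ‖ = 1

/-- `f` is an entire function that extends the orbit `t ↦ α t a`.  The element `a` is analytic
for `α` if there is such an `f`; then `f` is unique and `α z a` means `f z`. -/
def IsAnalyticOrbit (α : ℝ → B ≃⋆ₐ[ℂ] B) (a : B) (f : ℂ → B) : Prop :=
  Differentiable ℂ f ∧ ∀ t : ℝ, f t = α t a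

/-- `φ` is a KMS state for `α` at inverse temperature `β`: a state such that
`φ (a b) = φ (b (α (iβ) a))` for all analytic elements `a` and `b`. -/
def IsKMSState (α : ℝ → B ≃⋆ₐ[ℂ] B) (β : ℝ) (φ : WeakDual ℂ B) : Prop :=
  IsState φ ∧ ∀ (a b : B) (f g : ℂ → B), IsAnalyticOrbit α a f → IsAnalyticOrbit α b g →
    φ (a * b) = φ (b * f (β * Complex.I))

end

/-- `K` is a simplex with vertices indexed by `ι`: the convex hull of an affinely independent
family of points. -/
def IsSimplexOn (ι : Type*) {X : Type*} [AddCommGroup X] [Module ℝ X] (K : Set X) : Prop :=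
  ∃ x : ι → X, AffineIndependent ℝ x ∧ K = convexHull ℝ (Set.range x)

section

variable {V : Type u} {Ed : Type v} [Fintype V] [Fintype Ed] [DecidableEq V]

/-- The KMS states at inverse temperature `β` of the Toeplitz algebra with the gauge dynamics,
with the weak* topology. -/
def kmsStates (E : DirectedGraph V Ed) (β : ℝ) : Set (WeakDual ℂ (ToeplitzAlgebra E)) :=
  {φ | IsKMSState (Toeplitz.dynamics E) β φ}

/-- The `n`-th term `∑ w, e^{-β n} A^n(w, v)` of the series for `y^β_v`. -/
noncomputable def yTerm (E : DirectedGraph V Ed) (β : ℝ) (v : V) (n : ℕ) : ℝ :=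
  ∑ w, Real.exp (-β * n) * (E.realMatrix ^ n) w v

/-- The vector `y^β`. -/
noncomputable def yVec (E : DirectedGraph V Ed) (β : ℝ) (v : V) : ℝ :=
  ∑' n, yTerm E β v n

/-- The set `Δ_β` of the nonnegative vectors `ε` with `ε · y^β = 1`. -/
def deltaSimplex (E : DirectedGraph V Ed) (β : ℝ) : Set (V → ℝ) :=
  {ε | (∀ v, 0 ≤ ε v) ∧ ∑ v, ε v * yVec E β v = 1}

/-- The matrix `1 - e^{-β} A`. -/
noncomputable def resolventMatrix (E : DirectedGraph V Ed) (β : ℝ) : Matrix V V ℝ :=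
  1 - Real.exp (-β) • E.realMatrix

end

/-! ### The Neumann series of `e^{-β} A` and the simplex `Δ_β` -/

section MatrixSeries

variable {V : Type u} {Ed : Type v} [Fintype V] [Fintype Ed] [DecidableEq V]

/-! Write `M = e^{-β} A`. By Gelfand's formula the hypothesis on `β` makes `∑ M^n` converge
(`summable_weightedMatrix_pow`); the sum inverts `1 - M`, and the column sums of the inverse are the
`y_v`. The rest of the argument uses the hypothesis only through this summability.

Existence. The Toeplitz algebra acts on a Fock space with basis vectors `δ_μ`, where `S_e` puts `e`
in front of a path. For a vertex `w` sum the vector functionals `⟪δ_μ, T δ_μ⟫` over the paths `μ`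
with source `w`, with weights `e^{-β|μ|}`. The total weight is `y_w`. Prepending `e` multiplies the
weight by `e^{-β}`, which is exactly the KMS relation for `S_e` (`fockFunctional_creation_mul`). The
value at `p_v` is the weight of the paths from `w` to `v`, the entry `(1 - M)⁻¹(v, w)`
(`fockFunctional_vertexProj`). Combining these functionals with coefficients `ε_w` gives `φ_ε`,
linear in `ε`, positive for `ε ≥ 0`, and then of norm `∑ ε_w y_w`.

Uniqueness. The elements `s_μ s_ν*` span a dense subspace (`mem_closure_pathSpan`). The KMS relation
moves an edge of `ν` to the other side, where it cancels against an edge of `μ`; what remains are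
values at vertex projections and at `s_μ` with `μ` nonempty, and the latter vanish
(`IsGeneratorKMS.map_sPath_of_ne_nil`). Hence a KMS state is determined by its values at the `p_v`
(`IsGeneratorKMS.ext`).

Surjectivity. For a KMS state `φ` put `m_v = φ(p_v)`. The component of `(1 - M) m` at `v` is the
value of `φ` at the gap `p_v - ∑ s_e s_e*`, so it is nonnegative (`kmsVector_nonneg`). By uniqueness
`φ = φ_ε` for `ε = (1 - M) m`, and the norm formula puts `ε` in `Δ_β`. Both directions are
continuous because they involve only finitely many evaluations and finite sums.

The KMS condition for all analytic elements is linked to that for generators by density of the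
homogeneous elements in one direction and by the identity theorem for entire functions in the other.
-/

/-- The matrix `e^{-β} A`. -/
noncomputable def weightedMatrix (E : DirectedGraph V Ed) (β : ℝ) : Matrix V V ℝ :=
  Real.exp (-β) • E.realMatrix

theorem weightedMatrix_pow_apply (E : DirectedGraph V Ed) (β : ℝ) (n : ℕ) (v w : V) :
    (weightedMatrix E β ^ n) v w = Real.exp (-β * n) * (E.realMatrix ^ n) v w := by
  rw [weightedMatrix, smul_pow, Matrix.smul_apply, ← Real.exp_nat_mul, smul_eq_mul]
  ring_nf

theorem realMatrix_pow_apply (E : DirectedGraph V Ed) (n : ℕ) (v w : V) :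
    (E.realMatrix ^ n) v w = (((E.vertexMatrix ^ n) v w : ℕ) : ℝ) := by
  have : E.realMatrix ^ n = (E.vertexMatrix ^ n).map (Nat.cast : ℕ → ℝ) :=
    (map_pow (Nat.castRingHom ℝ).mapMatrix E.vertexMatrix n).symm
  rw [this, Matrix.map_apply]

theorem weightedMatrix_pow_nonneg (E : DirectedGraph V Ed) (β : ℝ) (n : ℕ) (v w : V) :
    0 ≤ (weightedMatrix E β ^ n) v w := by
  rw [weightedMatrix_pow_apply, realMatrix_pow_apply]; positivity

section

attribute [local instance] Matrix.linftyOpNormedRing Matrix.linftyOpNormedAlgebra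

theorem norm_apply_le_linftyOpNorm (M : Matrix V V ℂ) (v w : V) : ‖M v w‖ ≤ ‖M‖ := by
  rw [Matrix.linfty_opNorm_def]
  have h : ‖M v w‖₊ ≤ Finset.univ.sup fun i => ∑ j, ‖M i j‖₊ :=
    (Finset.single_le_sum (f := fun j => ‖M v j‖₊) (fun _ _ => zero_le) (Finset.mem_univ w)).trans
      (Finset.le_sup (f := fun i => ∑ j, ‖M i j‖₊) (Finset.mem_univ v))
  exact_mod_cast h

/-- Gelfand's formula bounds `‖A^n‖` by `r^n` for large `n`, in any Banach algebra norm; the `ℓ^∞`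
operator norm is convenient because it dominates every entry. -/
theorem exists_vertexMatrix_pow_le (E : DirectedGraph V Ed) {r : NNReal} (hr : E.rho < r) :
    ∀ᶠ n : ℕ in Filter.atTop, ∀ v w, (E.realMatrix ^ n) v w ≤ (r : ℝ) ^ n := by
  have h := spectrum.pow_nnnorm_pow_one_div_tendsto_nhds_spectralRadius
    (E.vertexMatrix.map (Nat.cast : ℕ → ℂ))
  filter_upwards [h.eventually (gt_mem_nhds hr), Filter.eventually_ge_atTop 1] with n hn hn1 v w
  have hn0 : (n : ℝ) ≠ 0 := by positivity
  have h1 := ENNReal.rpow_le_rpow hn.le (Nat.cast_nonneg (α := ℝ) n)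
  rw [← ENNReal.rpow_mul, one_div, inv_mul_cancel₀ hn0, ENNReal.rpow_one,
    ENNReal.rpow_natCast] at h1
  have h2 : ‖(E.vertexMatrix.map (Nat.cast : ℕ → ℂ)) ^ n‖₊ ≤ r ^ n := by exact_mod_cast h1
  have h3 : (E.vertexMatrix.map (Nat.cast : ℕ → ℂ)) ^ n
      = (E.vertexMatrix ^ n).map (Nat.cast : ℕ → ℂ) :=
    (map_pow (Nat.castRingHom ℂ).mapMatrix E.vertexMatrix n).symm
  have h4 := (norm_apply_le_linftyOpNorm _ v w).trans (show _ ≤ ((r : ℝ) ^ n) from by exact_mod_cast h2)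
  rw [h3, Matrix.map_apply, Complex.norm_natCast] at h4
  rwa [realMatrix_pow_apply]

end

theorem summable_weightedMatrix_pow (E : DirectedGraph V Ed) {β : ℝ}
    (hβ : ENNReal.log E.rho < (β : EReal)) : Summable fun n => weightedMatrix E β ^ n := by
  have h1 : E.rho < ENNReal.ofReal (Real.exp β) := by
    rw [← ENNReal.log_lt_log_iff]
    refine hβ.trans_eq ?_
    rw [ENNReal.log_ofReal_of_pos (Real.exp_pos β), Real.log_exp]
  -- Room between `ρ(A)` and `e^β` gives a geometric majorant with ratio `e^{-β} r < 1`.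
  obtain ⟨r, hr, hr2⟩ := ENNReal.lt_iff_exists_nnreal_btwn.1 h1
  have hr3 : (r : ℝ) < Real.exp β := by
    rwa [← ENNReal.ofReal_coe_nnreal, ENNReal.ofReal_lt_ofReal_iff (Real.exp_pos β)] at hr2
  have hq : Real.exp (-β) * r < 1 := by
    calc Real.exp (-β) * r < Real.exp (-β) * Real.exp β := by gcongr
      _ = 1 := by rw [← Real.exp_add]; simp
  refine Pi.summable.2 fun v => Pi.summable.2 fun w => ?_
  refine .of_norm_bounded_eventually_nat (summable_geometric_of_lt_one (by positivity) hq) ?_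
  filter_upwards [exists_vertexMatrix_pow_le E hr] with n hn
  rw [Real.norm_of_nonneg (weightedMatrix_pow_nonneg E β n v w), weightedMatrix_pow_apply, mul_pow,
    ← Real.exp_nat_mul, mul_comm (n : ℝ)]
  gcongr
  exact hn v w

variable {E : DirectedGraph V Ed} {β : ℝ}

theorem resolventMatrix_mul_tsum
    (hs : Summable fun n => weightedMatrix E β ^ n) : resolventMatrix E β * ∑' n, weightedMatrix E β ^ n = 1 :=
  hs.one_sub_mul_tsum_pow

theorem isUnit_resolventMatrix
    (hs : Summable fun n => weightedMatrix E β ^ n) : IsUnit (resolventMatrix E β) :=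
  IsUnit.of_mul_eq_one _ (resolventMatrix_mul_tsum hs)

theorem hasSum_resolventMatrix_inv
    (hs : Summable fun n => weightedMatrix E β ^ n) (v w : V) :
    HasSum (fun n => (weightedMatrix E β ^ n) v w) ((resolventMatrix E β)⁻¹ v w) := by
  rw [Matrix.inv_eq_right_inv (resolventMatrix_mul_tsum hs)]
  exact Pi.hasSum.1 (Pi.hasSum.1 hs.hasSum v) w

theorem hasSum_yTerm
    (hs : Summable fun n => weightedMatrix E β ^ n) (v : V) :
    HasSum (yTerm E β v) (∑ w, (resolventMatrix E β)⁻¹ w v) := by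
  have h := hasSum_sum (s := Finset.univ) fun w _ => hasSum_resolventMatrix_inv hs w v
  simp only [weightedMatrix_pow_apply] at h
  exact h

theorem yVec_eq
    (hs : Summable fun n => weightedMatrix E β ^ n) (v : V) : yVec E β v = ∑ w, (resolventMatrix E β)⁻¹ w v :=
  (hasSum_yTerm hs v).tsum_eq

theorem yVec_pos
    (hs : Summable fun n => weightedMatrix E β ^ n) (v : V) : 0 < yVec E β v := by
  have h : ∀ n, 0 ≤ yTerm E β v n := fun n => Finset.sum_nonneg fun w _ => by
    rw [← weightedMatrix_pow_apply]; exact weightedMatrix_pow_nonneg E β n w v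
  -- The term `n = 0` already contributes `1`, the column sum of the identity matrix.
  refine lt_of_lt_of_le ?_ ((hasSum_yTerm hs v).summable.le_tsum 0 fun n _ => h n)
  simp [yTerm, Matrix.one_apply]

/-- Linear rather than affine independence is recorded because it passes directly through the
injective linear map `kmsMap` to the vertices of the KMS simplex. -/
theorem linearIndependent_deltaVertex (hs : Summable fun n => weightedMatrix E β ^ n) :
    LinearIndependent ℝ (fun v => (yVec E β v)⁻¹ • (Pi.single v 1 : V → ℝ)) := by
  have h := (Pi.basisFun ℝ V).linearIndependent.units_smul
    (fun v => Units.mk0 _ (inv_ne_zero (yVec_pos hs v).ne'))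
  convert h using 2 with v
  simp [Units.smul_def]

/-- The diagonal scaling by `1 / y_v` carries the standard simplex onto `Δ_β`, and linear maps
commute with convex hulls. -/
theorem deltaSimplex_eq_convexHull (hs : Summable fun n => weightedMatrix E β ^ n) :
    deltaSimplex E β
      = convexHull ℝ (Set.range fun v => (yVec E β v)⁻¹ • (Pi.single v 1 : V → ℝ)) := by
  have hy := yVec_pos hs
  let D : (V → ℝ) →ₗ[ℝ] (V → ℝ) :=
    LinearMap.pi fun v => (yVec E β v)⁻¹ • LinearMap.proj (φ := fun _ => ℝ) v
  have h : (fun v => (yVec E β v)⁻¹ • (Pi.single v 1 : V → ℝ))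
      = D ∘ fun v => (Pi.single v 1 : V → ℝ) := by
    ext v w
    by_cases hvw : w = v
    · subst hvw; simp [D]
    · simp [D, Pi.single_eq_of_ne hvw]
  rw [h, Set.range_comp, ← D.image_convexHull, convexHull_rangle_single_eq_stdSimplex]
  ext ε
  constructor
  · rintro ⟨h0, h1⟩
    refine ⟨fun v => ε v * yVec E β v, ⟨fun v => mul_nonneg (h0 v) (hy v).le, h1⟩, ?_⟩
    ext v
    simp [D, mul_comm (ε v), inv_mul_cancel_left₀ (hy v).ne']
  · rintro ⟨c, ⟨hc0, hc1⟩, rfl⟩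
    refine ⟨fun v => mul_nonneg (inv_nonneg.2 (hy v).le) (hc0 v), ?_⟩
    rw [← hc1]
    refine Finset.sum_congr rfl fun v _ => ?_
    simp [D, mul_comm _ (c v), mul_assoc, inv_mul_cancel₀ (hy v).ne']

end MatrixSeries

/-! ### Diagonal operators and shifts on `ℓ²(X)` -/

section SequenceOperators

open scoped Classical in
/-- The standard basis vector of `ℓ²(X)` at `x`. -/
noncomputable def ket {X : Type*} (x : X) : lp (fun _ : X => ℂ) 2 := lp.single 2 x 1

variable {X : Type*}

theorem ket_apply_self (x : X) : ket x x = 1 := by simp [ket]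

open scoped Classical in
theorem ket_apply_of_ne {x y : X} (h : y ≠ x) : ket x y = 0 := by
  rw [ket, lp.single_apply_ne _ _ _ h]

open scoped Classical in
theorem norm_ket (x : X) : ‖ket x‖ = 1 := by
  rw [ket, lp.norm_single (by norm_num)]; simp

open scoped Classical in
theorem inner_ket_left (x : X) (f : lp (fun _ : X => ℂ) 2) : inner ℂ (ket x) f = f x := by
  rw [ket, lp.inner_single_left]; simp

/-- Multiplication by a function of modulus at most one, as an operator on `ℓ²(X)`. -/
noncomputable def diagOp (d : X → ℂ) (hd : ∀ x, ‖d x‖ ≤ 1) :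
    lp (fun _ : X => ℂ) 2 →L[ℂ] lp (fun _ : X => ℂ) 2 :=
  have hb : ∀ (f : lp (fun _ : X => ℂ) 2) (s : Finset X),
      ∑ x ∈ s, ‖d x * f x‖ ^ (2 : ℝ≥0∞).toReal ≤ ‖f‖ ^ (2 : ℝ≥0∞).toReal := fun f s => by
    refine le_trans (Finset.sum_le_sum fun x _ => ?_) (lp.sum_rpow_le_norm_rpow (by norm_num) f s)
    refine Real.rpow_le_rpow (norm_nonneg _) ?_ (by norm_num)
    rw [norm_mul]
    exact mul_le_of_le_one_left (norm_nonneg _) (hd x)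
  LinearMap.mkContinuous
    { toFun f := ⟨fun x => d x * f x, memℓp_gen' (hb f)⟩
      map_add' f g := by ext x; exact mul_add _ _ _
      map_smul' c f := by ext x; exact mul_left_comm _ _ _ } 1 fun f => by
    rw [one_mul]
    exact lp.norm_le_of_forall_sum_le (by norm_num) (norm_nonneg _) (hb f)

theorem diagOp_apply (d : X → ℂ) (hd : ∀ x, ‖d x‖ ≤ 1) (f : lp (fun _ : X => ℂ) 2) (x : X) :
    diagOp d hd f x = d x * f x := rfl

theorem star_diagOp (d : X → ℂ) (hd : ∀ x, ‖d x‖ ≤ 1) :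
    star (diagOp d hd) = diagOp (fun x => star (d x)) (fun x => by rw [norm_star]; exact hd x) := by
  rw [ContinuousLinearMap.star_eq_adjoint, eq_comm, ContinuousLinearMap.eq_adjoint_iff]
  intro f g
  rw [lp.inner_eq_tsum, lp.inner_eq_tsum]
  refine tsum_congr fun x => ?_
  simp only [diagOp_apply, RCLike.inner_apply, map_mul, RCLike.star_def, RingHomCompTriple.comp_apply, RingHom.id_apply]
  ring

/-- The projection onto the functions supported in a subset. -/
noncomputable def suppProj (D : Set X) : lp (fun _ : X => ℂ) 2 →L[ℂ] lp (fun _ : X => ℂ) 2 :=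
  diagOp (D.indicator 1) fun x => by
    by_cases hx : x ∈ D <;> simp [hx]

theorem suppProj_apply_of_mem {D : Set X} (f : lp (fun _ : X => ℂ) 2) {x : X} (hx : x ∈ D) :
    suppProj D f x = f x := by
  simp [suppProj, diagOp_apply, hx]

theorem suppProj_apply_of_notMem {D : Set X} (f : lp (fun _ : X => ℂ) 2) {x : X} (hx : x ∉ D) :
    suppProj D f x = 0 := by
  simp [suppProj, diagOp_apply, hx]

theorem star_suppProj (D : Set X) : star (suppProj D) = suppProj D := by
  rw [suppProj, star_diagOp]
  congr 1
  ext x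
  by_cases hx : x ∈ D <;> simp [hx]

theorem suppProj_mul (C D : Set X) : suppProj C * suppProj D = suppProj (C ∩ D) := by
  ext f x
  rw [mul_apply_eq_comp]
  by_cases hC : x ∈ C <;> by_cases hD : x ∈ D <;>
    simp [suppProj, diagOp_apply, hC, hD]

theorem suppProj_empty : suppProj (∅ : Set X) = 0 := by
  ext f x
  rw [suppProj_apply_of_notMem f (Set.notMem_empty x)]; rfl

theorem isStarProjection_suppProj (D : Set X) : IsStarProjection (suppProj D) :=
  ⟨by rw [IsIdempotentElem, suppProj_mul, Set.inter_self], star_suppProj D⟩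

/-- Composition with an injective map, as an operator on `ℓ²(X)`. -/
noncomputable def pullOp (j : X ↪ X) : lp (fun _ : X => ℂ) 2 →L[ℂ] lp (fun _ : X => ℂ) 2 :=
  have hb : ∀ (f : lp (fun _ : X => ℂ) 2) (s : Finset X),
      ∑ x ∈ s, ‖f (j x)‖ ^ (2 : ℝ≥0∞).toReal ≤ ‖f‖ ^ (2 : ℝ≥0∞).toReal := fun f s => by
    rw [← Finset.sum_map s j fun y => ‖f y‖ ^ (2 : ℝ≥0∞).toReal]
    exact lp.sum_rpow_le_norm_rpow (by norm_num) f _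
  LinearMap.mkContinuous
    { toFun f := ⟨fun x => f (j x), memℓp_gen' (hb f)⟩
      map_add' f g := rfl
      map_smul' c f := rfl } 1 fun f => by
    rw [one_mul]
    exact lp.norm_le_of_forall_sum_le (by norm_num) (norm_nonneg _) (hb f)

theorem pullOp_apply (j : X ↪ X) (f : lp (fun _ : X => ℂ) 2) (x : X) :
    pullOp j f x = f (j x) := rfl

theorem pullOp_ket (j : X ↪ X) (x : X) : pullOp j (ket (j x)) = ket x := by
  ext y
  rw [pullOp_apply]
  by_cases h : y = x
  · subst h; rw [ket_apply_self, ket_apply_self]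
  · rw [ket_apply_of_ne h, ket_apply_of_ne fun h' => h (j.injective h')]

theorem pullOp_ket_of_notMem (j : X ↪ X) {y : X} (h : ∀ x, j x ≠ y) : pullOp j (ket y) = 0 := by
  ext x
  rw [pullOp_apply, ket_apply_of_ne (h x)]; rfl

/-- Coordinates are inner products with basis vectors. This gives the coordinates of the adjoint of
`pullOp j` from the action of `pullOp j` on basis vectors. -/
theorem apply_eq_inner_star (T : lp (fun _ : X => ℂ) 2 →L[ℂ] lp (fun _ : X => ℂ) 2)
    (f : lp (fun _ : X => ℂ) 2) (x : X) : T f x = inner ℂ (star T (ket x)) f := by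
  rw [ContinuousLinearMap.star_eq_adjoint, ContinuousLinearMap.adjoint_inner_left, inner_ket_left]

theorem star_pullOp_apply (j : X ↪ X) (f : lp (fun _ : X => ℂ) 2) (x : X) :
    star (pullOp j) f (j x) = f x := by
  rw [apply_eq_inner_star, star_star, pullOp_ket, inner_ket_left]

theorem star_pullOp_apply_of_notMem (j : X ↪ X) (f : lp (fun _ : X => ℂ) 2) {y : X}
    (h : ∀ x, j x ≠ y) : star (pullOp j) f y = 0 := by
  rw [apply_eq_inner_star, star_star, pullOp_ket_of_notMem j h, inner_zero_left]

theorem pullOp_mul_star (j : X ↪ X) : pullOp j * star (pullOp j) = 1 := by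
  ext f x
  rw [mul_apply_eq_comp, pullOp_apply, star_pullOp_apply]; rfl

theorem star_pullOp_ket (j : X ↪ X) (x : X) : star (pullOp j) (ket x) = ket (j x) := by
  ext y
  by_cases h : ∃ z, j z = y
  · obtain ⟨z, rfl⟩ := h
    rw [star_pullOp_apply]
    by_cases h : z = x
    · rw [h, ket_apply_self, ket_apply_self]
    · rw [ket_apply_of_ne h, ket_apply_of_ne fun h' => h (j.injective h')]
  · push Not at h
    rw [star_pullOp_apply_of_notMem _ _ h, ket_apply_of_ne (h x).symm]

theorem suppProj_ket_of_mem {D : Set X} {x : X} (hx : x ∈ D) : suppProj D (ket x) = ket x := by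
  ext y
  by_cases hy : y ∈ D
  · rw [suppProj_apply_of_mem _ hy]
  · rw [suppProj_apply_of_notMem _ hy, ket_apply_of_ne]
    rintro rfl; exact hy hx

theorem suppProj_ket_of_notMem {D : Set X} {x : X} (hx : x ∉ D) : suppProj D (ket x) = 0 := by
  ext y
  by_cases hy : y ∈ D
  · rw [suppProj_apply_of_mem _ hy, ket_apply_of_ne]
    · rfl
    rintro rfl; exact hx hy
  · rw [suppProj_apply_of_notMem _ hy]; rfl

end SequenceOperators

/-! ### The Fock representation and its gauge unitaries -/

section Fock

variable {V : Type u} {Ed : Type v}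

namespace DirectedGraph

/-- The range of a list of edges that is followed from the vertex in the second component. -/
def rng (E : DirectedGraph V Ed) : List Ed × V → V
  | ([], v) => v
  | (e :: _, _) => E.r e

/-- Putting an edge in front of a list of edges. -/
def consEmb (e : Ed) : List Ed × V ↪ List Ed × V :=
  ⟨fun x => (e :: x.1, x.2), fun x y h => by
    simpa [Prod.ext_iff] using h⟩

theorem consEmb_apply (e : Ed) (x : List Ed × V) : consEmb e x = (e :: x.1, x.2) := rfl

theorem consEmb_ne_nil (e : Ed) (x : List Ed × V) (v : V) : consEmb e x ≠ ([], v) := by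
  simp [consEmb_apply]

theorem consEmb_ne_consEmb {e f : Ed} (h : e ≠ f) (x y : List Ed × V) :
    consEmb e x ≠ consEmb f y := by
  simp [consEmb_apply, h]

theorem nil_or_consEmb (x : List Ed × V) : (∃ v, x = ([], v)) ∨ ∃ e y, x = consEmb e y := by
  obtain ⟨_ | ⟨e, l⟩, v⟩ := x
  · exact .inl ⟨v, rfl⟩
  · exact .inr ⟨e, (l, v), rfl⟩

/-- The lists of edges with range `v`. -/
def rngSet (E : DirectedGraph V Ed) (v : V) : Set (List Ed × V) := {x | E.rng x = v}

theorem mem_rngSet {E : DirectedGraph V Ed} {v : V} {x : List Ed × V} :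
    x ∈ E.rngSet v ↔ E.rng x = v := Iff.rfl

/-- The lists of edges with range `v` whose first edge does not fit to the rest. -/
def gapSet (E : DirectedGraph V Ed) (v : V) : Set (List Ed × V) :=
  {x | E.rng x = v ∧ ∀ e y, x = consEmb e y → E.rng y ≠ E.s e}

theorem nil_mem_gapSet {E : DirectedGraph V Ed} {v w : V} :
    (([], w) : List Ed × V) ∈ E.gapSet v ↔ w = v :=
  ⟨fun h => h.1, fun h => ⟨h, fun e y h => absurd h.symm (consEmb_ne_nil e y w)⟩⟩

theorem consEmb_mem_gapSet {E : DirectedGraph V Ed} {v : V} {e : Ed} {x : List Ed × V} :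
    consEmb e x ∈ E.gapSet v ↔ E.r e = v ∧ E.rng x ≠ E.s e := by
  refine ⟨fun h => ⟨h.1, h.2 e x rfl⟩, fun h => ⟨h.1, fun f y hy => ?_⟩⟩
  by_cases hef : e = f
  · subst hef
    rw [← consEmb e |>.injective hy]; exact h.2
  · exact absurd hy (consEmb_ne_consEmb hef x y)

end DirectedGraph

open DirectedGraph

/-- The creation operators on `ℓ²(List Ed × V)`. -/
noncomputable def creation (E : DirectedGraph V Ed) (e : Ed) :
    lp (fun _ : List Ed × V => ℂ) 2 →L[ℂ] lp (fun _ : List Ed × V => ℂ) 2 :=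
  star (pullOp (consEmb e)) * suppProj (E.rngSet (E.s e))

theorem star_creation (E : DirectedGraph V Ed) (e : Ed) :
    star (creation E e) = suppProj (E.rngSet (E.s e)) * pullOp (consEmb e) := by
  rw [creation, star_mul, star_star, star_suppProj]

theorem star_creation_mul_creation (E : DirectedGraph V Ed) (e : Ed) :
    star (creation E e) * creation E e = suppProj (E.rngSet (E.s e)) := by
  rw [star_creation, creation, mul_assoc, ← mul_assoc (pullOp _), pullOp_mul_star, one_mul,
    suppProj_mul, Set.inter_self]

theorem creation_apply_of_notMem (E : DirectedGraph V Ed) {e : Ed}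
    (f : lp (fun _ : List Ed × V => ℂ) 2) {x : List Ed × V} (h : ∀ y, consEmb e y ≠ x) :
    creation E e f x = 0 := by
  rw [creation, mul_apply_eq_comp, star_pullOp_apply_of_notMem _ _ h]

theorem creation_apply_consEmb (E : DirectedGraph V Ed) (e : Ed)
    (f : lp (fun _ : List Ed × V => ℂ) 2) (x : List Ed × V) :
    creation E e f (consEmb e x) = suppProj (E.rngSet (E.s e)) f x := by
  rw [creation, mul_apply_eq_comp, star_pullOp_apply]

theorem star_creation_ket_of_notMem (E : DirectedGraph V Ed) {e : Ed} {x : List Ed × V}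
    (h : ∀ y, consEmb e y ≠ x) : star (creation E e) (ket x) = 0 := by
  rw [star_creation, mul_apply_eq_comp, pullOp_ket_of_notMem _ h, map_zero]

theorem star_creation_ket_consEmb (E : DirectedGraph V Ed) {e : Ed} {x : List Ed × V}
    (h : E.rng x = E.s e) : star (creation E e) (ket (consEmb e x)) = ket x := by
  rw [star_creation, mul_apply_eq_comp, pullOp_ket]
  exact suppProj_ket_of_mem h

theorem creation_ket_of_rng_eq (E : DirectedGraph V Ed) {e : Ed} {x : List Ed × V}
    (h : E.rng x = E.s e) : creation E e (ket x) = ket (consEmb e x) := by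
  rw [creation, mul_apply_eq_comp, suppProj_ket_of_mem (mem_rngSet.2 h), star_pullOp_ket]

theorem creation_ket_of_rng_ne (E : DirectedGraph V Ed) {e : Ed} {x : List Ed × V}
    (h : E.rng x ≠ E.s e) : creation E e (ket x) = 0 := by
  rw [creation, mul_apply_eq_comp, suppProj_ket_of_notMem (mt mem_rngSet.1 h), map_zero]

theorem creation_mul_star_apply (E : DirectedGraph V Ed) (e : Ed)
    (f : lp (fun _ : List Ed × V => ℂ) 2) (x : List Ed × V) :
    creation E e (star (creation E e) f) (consEmb e x)
      = suppProj (E.rngSet (E.s e)) (pullOp (consEmb e) f) x := by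
  rw [creation_apply_consEmb, star_creation, mul_apply_eq_comp, ← mul_apply_eq_comp,
    suppProj_mul, Set.inter_self]

/-- The unitaries on Fock space that implement the gauge action. -/
noncomputable def gaugeOp (z : Circle) :
    lp (fun _ : List Ed × V => ℂ) 2 →L[ℂ] lp (fun _ : List Ed × V => ℂ) 2 :=
  diagOp (fun x => (z : ℂ) ^ x.1.length) fun x => by
    rw [norm_pow, Circle.norm_coe, one_pow]

theorem gaugeOp_mem_unitary (z : Circle) : gaugeOp z ∈
    unitary (lp (fun _ : List Ed × V => ℂ) 2 →L[ℂ] lp (fun _ : List Ed × V => ℂ) 2) := by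
  have hz : (z : ℂ) * star (z : ℂ) = 1 := by
    rw [RCLike.star_def, Complex.mul_conj, Circle.normSq_coe]; simp
  rw [Unitary.mem_iff, gaugeOp]
  constructor
  all_goals
    ext f x
    rw [star_diagOp, mul_apply_eq_comp, diagOp_apply, diagOp_apply, ← mul_assoc, star_pow,
      ← mul_pow]
    simp only [hz, mul_comm (star (z : ℂ)), one_pow, one_mul]
    rfl

theorem gaugeOp_apply (z : Circle) (f : lp (fun _ : List Ed × V => ℂ) 2) (x : List Ed × V) :
    gaugeOp z f x
      = (z : ℂ) ^ x.1.length * f x := rfl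

theorem star_gaugeOp_ket (z : Circle) (x : List Ed × V) :
    star (gaugeOp z) (ket x)
      = star ((z : ℂ) ^ x.1.length) • ket x := by
  rw [gaugeOp, star_diagOp]
  ext y
  rw [diagOp_apply, lp.coeFn_smul, Pi.smul_apply, smul_eq_mul]
  by_cases h : y = x
  · rw [h]
  · rw [ket_apply_of_ne h, mul_zero, mul_zero]

theorem gaugeOp_mul_creation (E : DirectedGraph V Ed) (z : Circle) (e : Ed) :
    gaugeOp z * creation E e
      = (z : ℂ) • (creation E e * gaugeOp z) := by
  ext f x
  rw [smul_apply, lp.coeFn_smul, Pi.smul_apply, mul_apply_eq_comp, mul_apply_eq_comp,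
    gaugeOp_apply, smul_eq_mul]
  by_cases h : ∃ y, consEmb e y = x
  · obtain ⟨y, rfl⟩ := h
    rw [creation_apply_consEmb, creation_apply_consEmb]
    by_cases hy : E.rng y = E.s e
    · rw [suppProj_apply_of_mem (D := E.rngSet (E.s e)) _ hy,
        suppProj_apply_of_mem (D := E.rngSet (E.s e)) _ hy, gaugeOp_apply, consEmb_apply,
        List.length_cons, pow_succ', mul_assoc]
    · rw [suppProj_apply_of_notMem _ (mt mem_rngSet.1 hy),
        suppProj_apply_of_notMem _ (mt mem_rngSet.1 hy), mul_zero, mul_zero]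
  · push Not at h
    rw [creation_apply_of_notMem E _ h, creation_apply_of_notMem E _ h, mul_zero, mul_zero]

theorem gaugeOp_mul_suppProj (D : Set (List Ed × V)) (z : Circle) :
    gaugeOp z * suppProj D
      = suppProj D * gaugeOp z := by
  ext f x
  rw [mul_apply_eq_comp, mul_apply_eq_comp, gaugeOp_apply]
  by_cases h : x ∈ D
  · rw [suppProj_apply_of_mem _ h, suppProj_apply_of_mem _ h, gaugeOp_apply]
  · rw [suppProj_apply_of_notMem _ h, suppProj_apply_of_notMem _ h, mul_zero]

variable [Fintype Ed] [DecidableEq V]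

/-- All lists of edges are basis vectors, not only paths. At a coordinate `e :: l` only the summand
of `e` can act, and it acts as the identity exactly when `e` fits onto `l`. The gap is thus carried
by the empty list at `v` and by the lists with range `v` whose first edge does not fit. The
ill-fitting lists are harmless, since a Toeplitz family needs only a positive gap. -/
theorem gap_fock (E : DirectedGraph V Ed) (v : V) :
    suppProj (E.rngSet v) - ∑ e ∈ Finset.univ.filter (fun e => E.r e = v),
      creation E e * star (creation E e) = suppProj (E.gapSet v) := by
  classical
  ext f x
  have hsum : ∀ s : Finset Ed, ((∑ e ∈ s, creation E e * star (creation E e)) f) x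
      = ∑ e ∈ s, creation E e (star (creation E e) f) x := fun s => by
    rw [sum_apply, lp.coeFn_sum, Finset.sum_apply]
    rfl
  rw [sub_apply, lp.coeFn_sub, Pi.sub_apply, hsum]
  obtain ⟨w, rfl⟩ | ⟨e, y, rfl⟩ := nil_or_consEmb x
  · rw [Finset.sum_eq_zero fun e _ => creation_apply_of_notMem E _ fun y => consEmb_ne_nil e y w,
      sub_zero]
    by_cases hw : w = v
    · rw [suppProj_apply_of_mem _ (nil_mem_gapSet.2 hw), suppProj_apply_of_mem]
      exact hw
    · rw [suppProj_apply_of_notMem _ (mt nil_mem_gapSet.1 hw), suppProj_apply_of_notMem]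
      exact hw
  · by_cases hv : E.r e = v
    · rw [Finset.sum_eq_single_of_mem e (by simp [hv]) fun e' _ he' =>
        creation_apply_of_notMem E _ fun z => consEmb_ne_consEmb he' z y,
        creation_mul_star_apply, suppProj_apply_of_mem (D := E.rngSet v) f hv]
      by_cases hy : E.rng y = E.s e
      · rw [suppProj_apply_of_mem (D := E.rngSet (E.s e)) _ hy, pullOp_apply, sub_self,
          suppProj_apply_of_notMem _ fun h => (consEmb_mem_gapSet.1 h).2 hy]
      · rw [suppProj_apply_of_notMem _ (mt mem_rngSet.1 hy), sub_zero,
          suppProj_apply_of_mem _ (consEmb_mem_gapSet.2 ⟨hv, hy⟩)]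
    · rw [suppProj_apply_of_notMem (D := E.rngSet v) f (x := consEmb e y) (mt mem_rngSet.1 hv),
        suppProj_apply_of_notMem _ fun h => hv (consEmb_mem_gapSet.1 h).1,
        Finset.sum_eq_zero, sub_zero]
      intro e' he'
      refine creation_apply_of_notMem E _ fun z => consEmb_ne_consEmb ?_ z y
      rintro rfl
      exact hv (by simpa using he')

/-- The Fock representation. -/
noncomputable def fockFamily (E : DirectedGraph V Ed) :
    TCKFamily E (lp (fun _ : List Ed × V => ℂ) 2 →L[ℂ] lp (fun _ : List Ed × V => ℂ) 2) where
  P v := suppProj (E.rngSet v)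
  S e := creation E e
  isProj v := isStarProjection_suppProj _
  orthogonal v w h := by
    rw [suppProj_mul, ← suppProj_empty]
    congr 1
    refine Set.eq_empty_of_forall_notMem fun x hx => h ?_
    exact (mem_rngSet.1 hx.1).symm.trans (mem_rngSet.1 hx.2)
  partialIsometry e := by
    rw [mul_assoc, star_creation_mul_creation, creation, mul_assoc, suppProj_mul, Set.inter_self]
  star_S_mul_S e := star_creation_mul_creation E e
  sum_le v := ⟨suppProj (E.gapSet v), by
    rw [gap_fock, star_suppProj, suppProj_mul, Set.inter_self]⟩

/-- The representation of the Toeplitz algebra on Fock space. -/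
noncomputable def fockHom (E : DirectedGraph V Ed) : ToeplitzAlgebra E →⋆ₙₐ[ℂ]
    (lp (fun _ : List Ed × V => ℂ) 2 →L[ℂ] lp (fun _ : List Ed × V => ℂ) 2) :=
  Toeplitz.coord ⟨_, fockFamily E⟩

theorem fockHom_p (E : DirectedGraph V Ed) (v : V) :
    fockHom E (Toeplitz.p E v) = suppProj (E.rngSet v) := rfl

theorem fockHom_s (E : DirectedGraph V Ed) (e : Ed) :
    fockHom E (Toeplitz.s E e) = creation E e := rfl

theorem fockHom_gauge (E : DirectedGraph V Ed) (z : Circle) (a : ToeplitzAlgebra E) :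
    fockHom E (Toeplitz.gauge E z a) = gaugeOp z
      * fockHom E a * star (gaugeOp z) := by
  have hU := Unitary.mul_star_self_of_mem (gaugeOp_mem_unitary (V := V) (Ed := Ed) z)
  let C : (lp (fun _ : List Ed × V => ℂ) 2 →L[ℂ] lp (fun _ : List Ed × V => ℂ) 2) →⋆ₙₐ[ℂ]
      (lp (fun _ : List Ed × V => ℂ) 2 →L[ℂ] lp (fun _ : List Ed × V => ℂ) 2) :=
    (Unitary.conjStarAlgAut ℂ _ ⟨gaugeOp z, gaugeOp_mem_unitary z⟩).toNonUnitalStarAlgHom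
  have h : (fockHom E).comp (Toeplitz.gaugeHom E z) = C.comp (fockHom E) := by
    refine Toeplitz.hom_ext (fun v => ?_) (fun e => ?_)
    · change suppProj _ = gaugeOp z * suppProj _
        * star (gaugeOp z)
      rw [gaugeOp_mul_suppProj, mul_assoc, hU, mul_one]
    · change (z : ℂ) • creation E e
        = gaugeOp z * creation E e
        * star (gaugeOp z)
      rw [gaugeOp_mul_creation, smul_mul_assoc, mul_assoc, hU, mul_one]
  exact DFunLike.congr_fun h a

/-- The gauge unitaries are diagonal, so the phases cancel in a diagonal matrix coefficient. This is
the source of the invariance of `φ_ε` under the dynamics. -/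
theorem inner_ket_fockHom_gauge (E : DirectedGraph V Ed) (z : Circle) (a : ToeplitzAlgebra E)
    (x : List Ed × V) : inner ℂ (ket x) (fockHom E (Toeplitz.gauge E z a) (ket x))
      = inner ℂ (ket x) (fockHom E a (ket x)) := by
  rw [fockHom_gauge, mul_apply_eq_comp, mul_apply_eq_comp, star_gaugeOp_ket, map_smul,
    map_smul, inner_ket_left, inner_ket_left, lp.coeFn_smul, Pi.smul_apply, gaugeOp_apply,
    smul_eq_mul, ← mul_assoc]
  have hz : star (z : ℂ) * (z : ℂ) = 1 := by
    rw [RCLike.star_def, mul_comm, Complex.mul_conj, Circle.normSq_coe]; simp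
  rw [star_pow, ← mul_pow, hz, one_pow, one_mul]

end Fock

/-! ### Path weights and the KMS functionals on Fock space -/

section Weights

variable {V : Type u} {Ed : Type v} [DecidableEq V]

open DirectedGraph

/-- The weight `e^{-β |l|}` of a list of edges ending at `w` that is a path, and zero for
the other lists. -/
noncomputable def pathWeight (E : DirectedGraph V Ed) (β : ℝ) : List Ed → V → ℝ
  | [], _ => 1
  | e :: l, w => if E.rng (l, w) = E.s e then Real.exp (-β) * pathWeight E β l w else 0

theorem pathWeight_nonneg (E : DirectedGraph V Ed) (β : ℝ) (l : List Ed) (w : V) :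
    0 ≤ pathWeight E β l w := by
  induction l with
  | nil => exact zero_le_one
  | cons e l ih =>
    rw [pathWeight]
    split_ifs
    · exact mul_nonneg (Real.exp_pos _).le ih
    · exact le_rfl

variable [Fintype V] [Fintype Ed]

theorem weightedMatrix_pow_succ_apply (E : DirectedGraph V Ed) (β : ℝ) (n : ℕ) (v w : V) :
    (weightedMatrix E β ^ (n + 1)) v w
      = ∑ e, if E.r e = v then Real.exp (-β) * (weightedMatrix E β ^ n) (E.s e) w else 0 := by
  rw [pow_succ', Matrix.mul_apply]
  have h : ∀ u, weightedMatrix E β v u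
      = ∑ e, if E.r e = v ∧ E.s e = u then Real.exp (-β) else 0 := fun u => by
    rw [← Finset.sum_filter, Finset.sum_const, nsmul_eq_mul, mul_comm]
    rfl
  simp only [h, Finset.sum_mul]
  rw [Finset.sum_comm]
  refine Finset.sum_congr rfl fun e _ => ?_
  by_cases hv : E.r e = v
  · simp [hv, ite_mul]
  · simp [hv]

/-- Removing the first edge matches the recursion for matrix powers. Lists that are not paths have
weight zero, so the sum may run over all `n`-tuples of edges. -/
theorem sum_pathWeight_eq (E : DirectedGraph V Ed) (β : ℝ) (n : ℕ) (v w : V) :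
    ∑ l : Fin n → Ed, (if E.rng (List.ofFn l, w) = v then pathWeight E β (List.ofFn l) w else 0)
      = (weightedMatrix E β ^ n) v w := by
  induction n generalizing v with
  | zero =>
    simp only [List.ofFn_zero, pathWeight, DirectedGraph.rng, Finset.sum_const, Finset.card_univ,
      Fintype.card_unique, one_smul, pow_zero, Matrix.one_apply, eq_comm]
  | succ n ih =>
    rw [weightedMatrix_pow_succ_apply, ← (Fin.consEquiv fun _ => Ed).sum_comp,
      Fintype.sum_prod_type]
    refine Finset.sum_congr rfl fun e _ => ?_
    have h : ∀ l : Fin n → Ed, List.ofFn (Fin.consEquiv (fun _ => Ed) (e, l)) = e :: List.ofFn l :=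
      fun l => List.ofFn_cons e l
    simp only [h]
    change ∑ l : Fin n → Ed, (if E.r e = v then (if E.rng (List.ofFn l, w) = E.s e then
      Real.exp (-β) * pathWeight E β (List.ofFn l) w else 0) else 0) = _
    by_cases hv : E.r e = v
    · simp only [hv, if_true, ← ih, Finset.mul_sum, mul_ite, mul_zero]
    · simp only [hv, if_false, Finset.sum_const_zero]

variable {E : DirectedGraph V Ed} {β : ℝ}

theorem hasSum_pathWeight_rng (hs : Summable fun n => weightedMatrix E β ^ n) (v w : V) :
    HasSum (fun l => if E.rng (l, w) = v then pathWeight E β l w else 0)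
      ((resolventMatrix E β)⁻¹ v w) := by
  -- Lists are grouped by length; since the weights are nonnegative, summability of the sums over
  -- each length is enough.
  rw [← (List.equivSigmaTuple (α := Ed)).symm.hasSum_iff]
  have h : ∀ n, HasSum (fun l : Fin n → Ed =>
      ((fun l => if E.rng (l, w) = v then pathWeight E β l w else 0) ∘
        List.equivSigmaTuple.symm) ⟨n, l⟩) ((weightedMatrix E β ^ n) v w) := fun n => by
    rw [← sum_pathWeight_eq]
    exact hasSum_fintype _
  refine HasSum.sigma_of_hasSum (hasSum_resolventMatrix_inv hs v w) h ?_
  rw [summable_sigma_of_nonneg]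
  · refine ⟨fun n => (h n).summable, ?_⟩
    simp only [(h _).tsum_eq]
    exact (hasSum_resolventMatrix_inv hs v w).summable
  · intro x
    dsimp only [Function.comp_apply]
    split_ifs
    · exact pathWeight_nonneg _ _ _ _
    · exact le_rfl

theorem hasSum_pathWeight (hs : Summable fun n => weightedMatrix E β ^ n) (w : V) :
    HasSum (fun l => pathWeight E β l w) (yVec E β w) := by
  rw [yVec_eq hs]
  have h := hasSum_sum (s := Finset.univ) fun v _ => hasSum_pathWeight_rng hs v w
  simpa using h

/-! ### Summable combinations of vector functionals -/

section WeightedVectorFunctional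

variable {H ι : Type*} [NormedAddCommGroup H] [InnerProductSpace ℂ H]

/-- The functional `T ↦ ⟪h, T h⟫`. -/
noncomputable def vectorFunctional (h : H) : (H →L[ℂ] H) →L[ℂ] ℂ :=
  (innerSL ℂ h).comp (ContinuousLinearMap.apply ℂ H h)

theorem vectorFunctional_apply (h : H) (T : H →L[ℂ] H) :
    vectorFunctional h T = inner ℂ h (T h) := rfl

variable [CompleteSpace H]

theorem norm_smul_vectorFunctional_le {h : H} (hh : ‖h‖ = 1) {c : ℝ} (hc : 0 ≤ c) :
    ‖(c : ℂ) • vectorFunctional h‖ ≤ c := by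
  rw [norm_smul, Complex.norm_real, Real.norm_of_nonneg hc]
  refine mul_le_of_le_one_right hc (ContinuousLinearMap.opNorm_le_bound _ zero_le_one fun T => ?_)
  rw [vectorFunctional_apply, one_mul]
  refine (norm_inner_le_norm _ _).trans ?_
  simpa [hh] using T.le_opNorm h

/-- A weighted sum of vector functionals. -/
noncomputable def weightedFunctional (h : ι → H) (c : ι → ℝ) : (H →L[ℂ] H) →L[ℂ] ℂ :=
  ∑' i, (c i : ℂ) • vectorFunctional (h i)

variable {h : ι → H} {c : ι → ℝ} {y : ℝ}

theorem norm_weightedFunctional_le (hh : ∀ i, ‖h i‖ = 1) (hc : ∀ i, 0 ≤ c i) (hy : HasSum c y) :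
    ‖weightedFunctional h c‖ ≤ y :=
  tsum_of_norm_bounded hy fun i => norm_smul_vectorFunctional_le (hh i) (hc i)

/-- The defining series converges in norm because the weights are summable, so it may be evaluated
termwise. -/
theorem hasSum_weightedFunctional (hh : ∀ i, ‖h i‖ = 1) (hc : ∀ i, 0 ≤ c i) (hy : HasSum c y)
    (T : H →L[ℂ] H) :
    HasSum (fun i => (c i : ℂ) * inner ℂ (h i) (T (h i))) (weightedFunctional h c T) :=
  (Summable.of_norm_bounded hy.summable
    fun i => norm_smul_vectorFunctional_le (hh i) (hc i)).hasSum.mapL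
    (ContinuousLinearMap.apply ℂ ℂ T)

theorem weightedFunctional_star_mul_self_nonneg (hh : ∀ i, ‖h i‖ = 1)
    (hc : ∀ i, 0 ≤ c i) (hy : HasSum c y) (T : H →L[ℂ] H) :
    0 ≤ weightedFunctional h c (star T * T) := by
  refine (hasSum_weightedFunctional hh hc hy _).nonneg fun i => ?_
  rw [mul_apply_eq_comp, ContinuousLinearMap.star_eq_adjoint,
    ContinuousLinearMap.adjoint_inner_right]
  refine mul_nonneg (by exact_mod_cast hc i) ?_
  rw [inner_self_eq_norm_sq_to_K]
  exact Complex.zero_le_real.2 (sq_nonneg ‖T (h i)‖) |>.trans_eq (by push_cast; rfl)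

end WeightedVectorFunctional

/-- The functional on the operators on Fock space given by the weights of the paths
with source `w`. -/
noncomputable def fockFunctional (E : DirectedGraph V Ed) (β : ℝ) (w : V) :
    (lp (fun _ : List Ed × V => ℂ) 2 →L[ℂ] lp (fun _ : List Ed × V => ℂ) 2) →L[ℂ] ℂ :=
  weightedFunctional (fun l => ket (l, w)) fun l => pathWeight E β l w

theorem norm_fockFunctional_le (hs : Summable fun n => weightedMatrix E β ^ n) (w : V) :
    ‖fockFunctional E β w‖ ≤ yVec E β w :=
  norm_weightedFunctional_le (fun _ => norm_ket _) (fun l => pathWeight_nonneg E β l w)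
    (hasSum_pathWeight hs w)

theorem hasSum_fockFunctional (hs : Summable fun n => weightedMatrix E β ^ n) (w : V)
    (T : lp (fun _ : List Ed × V => ℂ) 2 →L[ℂ] lp (fun _ : List Ed × V => ℂ) 2) :
    HasSum (fun l => (pathWeight E β l w : ℂ) * inner ℂ (ket (l, w)) (T (ket (l, w))))
      (fockFunctional E β w T) :=
  hasSum_weightedFunctional (fun _ => norm_ket _) (fun l => pathWeight_nonneg E β l w)
    (hasSum_pathWeight hs w) T

/-- `S_e*` kills every basis vector whose list does not begin with `e`, so only the lists `e :: l`
contribute on the left. Moving `S_e` across the inner product turns such a term into the term of `l`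
on the right, and the weights differ by the factor `e^{-β}`. If `e` does not fit onto `l`, both
terms vanish. -/
theorem fockFunctional_creation_mul (hs : Summable fun n => weightedMatrix E β ^ n) (w : V)
    (e : Ed) (T : lp (fun _ : List Ed × V => ℂ) 2 →L[ℂ] lp (fun _ : List Ed × V => ℂ) 2) :
    fockFunctional E β w (creation E e * T)
      = Real.exp (-β) * fockFunctional E β w (T * creation E e) := by
  refine (hasSum_fockFunctional hs w _).unique ?_
  rw [← (List.cons_injective (a := e)).hasSum_iff]
  · have h := (hasSum_fockFunctional hs w (T * creation E e)).mul_left (Real.exp (-β) : ℂ)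
    refine Eq.mp (congrArg (fun f => HasSum f _) (funext fun l => ?_)) h
    change _ = (pathWeight E β (e :: l) w : ℂ) * inner ℂ (ket (consEmb e (l, w)))
      ((creation E e * T) (ket (consEmb e (l, w))))
    rw [mul_apply_eq_comp, mul_apply_eq_comp,
      ← ContinuousLinearMap.adjoint_inner_left (creation E e) (T _),
      ← ContinuousLinearMap.star_eq_adjoint, pathWeight]
    split_ifs with h
    · rw [star_creation_ket_consEmb E h, creation_ket_of_rng_eq E h]
      push_cast
      ring
    · rw [creation_ket_of_rng_ne E h, map_zero T, inner_zero_right]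
      simp
  · intro l hl
    rw [mul_apply_eq_comp, ← ContinuousLinearMap.adjoint_inner_left,
      ← ContinuousLinearMap.star_eq_adjoint, star_creation_ket_of_notMem, inner_zero_left, mul_zero]
    intro y hy
    exact hl ⟨y.1, congrArg Prod.fst hy⟩

theorem fockFunctional_suppProj_mul (hs : Summable fun n => weightedMatrix E β ^ n) (w : V)
    (D : Set (List Ed × V))
    (T : lp (fun _ : List Ed × V => ℂ) 2 →L[ℂ] lp (fun _ : List Ed × V => ℂ) 2) :
    fockFunctional E β w (suppProj D * T) = fockFunctional E β w (T * suppProj D) := by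
  refine (hasSum_fockFunctional hs w _).unique ?_
  convert hasSum_fockFunctional hs w (T * suppProj D) using 3 with l
  rw [mul_apply_eq_comp, mul_apply_eq_comp, inner_ket_left, inner_ket_left]
  by_cases h : (l, w) ∈ D
  · rw [suppProj_apply_of_mem _ h, suppProj_ket_of_mem h]
  · rw [suppProj_apply_of_notMem _ h, suppProj_ket_of_notMem h, map_zero]; rfl

theorem fockFunctional_vertexProj (hs : Summable fun n => weightedMatrix E β ^ n) (v w : V) :
    fockFunctional E β w (suppProj (E.rngSet v)) = ((resolventMatrix E β)⁻¹ v w : ℝ) := by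
  refine (hasSum_fockFunctional hs w _).unique ?_
  convert Complex.hasSum_ofReal.2 (hasSum_pathWeight_rng hs v w) using 2 with l
  rw [inner_ket_left]
  split_ifs with h
  · rw [suppProj_apply_of_mem (D := E.rngSet v) _ h, ket_apply_self, mul_one]
  · rw [suppProj_apply_of_notMem _ (mt mem_rngSet.1 h), mul_zero, Complex.ofReal_zero]

theorem fockFunctional_star_mul_self_nonneg (hs : Summable fun n => weightedMatrix E β ^ n)
    (w : V) (T : lp (fun _ : List Ed × V => ℂ) 2 →L[ℂ] lp (fun _ : List Ed × V => ℂ) 2) :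
    0 ≤ fockFunctional E β w (star T * T) := by
  exact weightedFunctional_star_mul_self_nonneg (fun _ => norm_ket _)
    (fun l => pathWeight_nonneg E β l w) (hasSum_pathWeight hs w) T

end Weights

/-! ### Density of the span of the elements `s_μ s_ν*` -/

section PathSpan

variable {V : Type u} {Ed : Type v} [Fintype Ed] [DecidableEq V]

open DirectedGraph

namespace TCKFamily

variable {E : DirectedGraph V Ed} {D : Type*} [NonUnitalCStarAlgebra D] (F : TCKFamily E D)

theorem P_mul_P_self (v : V) : F.P v * F.P v = F.P v := (F.isProj v).isIdempotentElem.eq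

theorem star_P (v : V) : star (F.P v) = F.P v := (F.isProj v).isSelfAdjoint.star_eq

theorem S_mul_P (e : Ed) : F.S e * F.P (E.s e) = F.S e := by
  rw [← F.star_S_mul_S, ← mul_assoc, F.partialIsometry]

theorem star_S_mul_P (e : Ed) : star (F.S e) * F.P (E.r e) = star (F.S e) := by
  rw [← F.star_P, ← star_mul, F.P_mul_S]

/-- For equal ranges the range projections of the two edges are orthogonal; for different ranges the
vertex projections are. -/
theorem star_S_mul_S_of_ne {e f : Ed} (h : f ≠ e) : star (F.S e) * F.S f = 0 := by
  by_cases hr : E.r f = E.r e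
  · rw [← F.partialIsometry f, ← F.partialIsometry e]
    have h1 := F.range_mul_range hr h
    calc star (F.S e * star (F.S e) * F.S e) * (F.S f * star (F.S f) * F.S f)
        = star (F.S e) * ((F.S e * star (F.S e)) * (F.S f * star (F.S f))) * F.S f := by
          simp only [star_mul, star_star, mul_assoc]
      _ = 0 := by rw [h1, mul_zero, zero_mul]
  · rw [← F.P_mul_S f, ← F.star_S_mul_P e, mul_assoc, ← mul_assoc (F.P _),
      F.orthogonal _ _ (Ne.symm hr), zero_mul, mul_zero]

end TCKFamily

namespace Toeplitz

variable {E : DirectedGraph V Ed}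

/-- An induction principle for the Toeplitz algebra. -/
theorem induction_on {C : ToeplitzAlgebra E → Prop} (hC : IsClosed {a | C a})
    (hp : ∀ v, C (p E v)) (hs : ∀ e, C (s E e)) (hadd : ∀ a b, C a → C b → C (a + b))
    (hmul : ∀ a b, C a → C b → C (a * b)) (hsmul : ∀ (z : ℂ) a, C a → C (z • a))
    (hzero : C 0) (hstar : ∀ a, C a → C (star a)) (a : ToeplitzAlgebra E) : C a := by
  have key : ∀ (x : Ambient E) (hx : x ∈ NonUnitalStarAlgebra.adjoin ℂ
      (Set.range (ambientP E) ∪ Set.range (ambientS E))), C ⟨x, subset_closure hx⟩ := by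
    intro x hx
    induction hx using NonUnitalStarAlgebra.adjoin_induction with
    | mem x hx =>
      rcases hx with ⟨w, rfl⟩ | ⟨e, rfl⟩
      · exact hp w
      · exact hs e
    | add x y hx hy h1 h2 => exact hadd _ _ h1 h2
    | zero => exact hzero
    | mul x y hx hy h1 h2 => exact hmul _ _ h1 h2
    | smul r x hx h1 => exact hsmul r _ h1
    | star x hx h1 => exact hstar _ h1
  obtain ⟨x, hx⟩ := a
  obtain ⟨u, hu, hux⟩ := mem_closure_iff_seq_limit.1 hx
  have hlim : Filter.Tendsto (fun n => (⟨u n, subset_closure (hu n)⟩ : ToeplitzAlgebra E))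
      Filter.atTop (nhds ⟨x, hx⟩) := tendsto_subtype_rng.2 hux
  exact hC.mem_of_tendsto hlim (Filter.Eventually.of_forall fun n => key _ (hu n))

theorem star_p (v : V) : star (p E v) = p E v := (universalFamily E).star_P v

theorem p_mul_p_self (v : V) : p E v * p E v = p E v := (universalFamily E).P_mul_P_self v

theorem p_mul_p_of_ne {v w : V} (h : v ≠ w) : p E v * p E w = 0 :=
  (universalFamily E).orthogonal v w h

theorem p_mul_s (e : Ed) : p E (E.r e) * s E e = s E e := (universalFamily E).P_mul_S e

theorem s_mul_p (e : Ed) : s E e * p E (E.s e) = s E e := (universalFamily E).S_mul_P e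

theorem star_s_mul_p (e : Ed) : star (s E e) * p E (E.r e) = star (s E e) :=
  (universalFamily E).star_S_mul_P e

theorem star_s_mul_s (e : Ed) : star (s E e) * s E e = p E (E.s e) :=
  (universalFamily E).star_S_mul_S e

theorem star_s_mul_s_of_ne {e f : Ed} (h : f ≠ e) : star (s E e) * s E f = 0 :=
  (universalFamily E).star_S_mul_S_of_ne h

/-- The product of the partial isometries of a list of edges and the projection at `v`. -/
noncomputable def sPath (E : DirectedGraph V Ed) : List Ed → V → ToeplitzAlgebra E
  | [], v => p E v
  | e :: l, v => s E e * sPath E l v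

theorem p_rng_mul_sPath (l : List Ed) (v : V) : p E (E.rng (l, v)) * sPath E l v = sPath E l v := by
  cases l with
  | nil => exact p_mul_p_self v
  | cons e l =>
    change p E (E.r e) * (s E e * sPath E l v) = s E e * sPath E l v
    rw [← mul_assoc, p_mul_s]

theorem p_mul_sPath_of_ne {l : List Ed} {v w : V} (h : w ≠ E.rng (l, v)) :
    p E w * sPath E l v = 0 := by
  rw [← p_rng_mul_sPath, ← mul_assoc, p_mul_p_of_ne h, zero_mul]

theorem sPath_mul_p (l : List Ed) (v : V) : sPath E l v * p E v = sPath E l v := by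
  induction l with
  | nil => exact p_mul_p_self v
  | cons e l ih => rw [sPath, mul_assoc, ih]

theorem sPath_mul_p_of_ne (l : List Ed) {v w : V} (h : v ≠ w) : sPath E l v * p E w = 0 := by
  rw [← sPath_mul_p, mul_assoc, p_mul_p_of_ne h, mul_zero]

theorem sPath_mul_s (l : List Ed) (e : Ed) :
    sPath E l (E.r e) * s E e = sPath E (l ++ [e]) (E.s e) := by
  induction l with
  | nil => exact (p_mul_s e).trans (s_mul_p e).symm
  | cons f l ih => rw [sPath, mul_assoc, ih]; rfl

theorem sPath_mul_s_of_ne (l : List Ed) {v : V} {e : Ed} (h : v ≠ E.r e) :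
    sPath E l v * s E e = 0 := by
  rw [← p_mul_s, ← mul_assoc, sPath_mul_p_of_ne l h, zero_mul]

/-- The element `s_μ s_ν*`. -/
noncomputable def monomial (E : DirectedGraph V Ed) (x : (List Ed × V) × (List Ed × V)) :
    ToeplitzAlgebra E :=
  sPath E x.1.1 x.1.2 * star (sPath E x.2.1 x.2.2)

/-- The span of the elements `s_μ s_ν*`. -/
noncomputable def pathSpan (E : DirectedGraph V Ed) : Submodule ℂ (ToeplitzAlgebra E) :=
  Submodule.span ℂ (Set.range (monomial E))

theorem monomial_mem_pathSpan (x : (List Ed × V) × (List Ed × V)) :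
    monomial E x ∈ pathSpan E := Submodule.subset_span ⟨x, rfl⟩

theorem mul_mem_closure_pathSpan {a : ToeplitzAlgebra E}
    (ha : ∀ x, a * monomial E x ∈ pathSpan E) {b : ToeplitzAlgebra E}
    (hb : b ∈ (pathSpan E).topologicalClosure) : a * b ∈ (pathSpan E).topologicalClosure := by
  have h : pathSpan E ≤ (pathSpan E).comap (LinearMap.mulLeft ℂ a) := by
    refine Submodule.span_le.2 ?_
    rintro _ ⟨x, rfl⟩
    exact ha x
  exact map_mem_closure (continuous_const_mul a) hb fun y hy => h hy

theorem p_mul_monomial_mem (v : V) (x : (List Ed × V) × (List Ed × V)) :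
    p E v * monomial E x ∈ pathSpan E := by
  rw [monomial, ← mul_assoc]
  by_cases h : v = E.rng x.1
  · rw [h, p_rng_mul_sPath]; exact monomial_mem_pathSpan x
  · rw [p_mul_sPath_of_ne h, zero_mul]; exact zero_mem _

theorem s_mul_monomial_mem (e : Ed) (x : (List Ed × V) × (List Ed × V)) :
    s E e * monomial E x ∈ pathSpan E := by
  rw [monomial, ← mul_assoc]
  exact monomial_mem_pathSpan ((e :: x.1.1, x.1.2), x.2)

theorem star_s_mul_monomial_mem (e : Ed) (x : (List Ed × V) × (List Ed × V)) :
    star (s E e) * monomial E x ∈ pathSpan E := by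
  obtain ⟨⟨_ | ⟨f, l⟩, v⟩, ⟨l', w⟩⟩ := x
  · change star (s E e) * (p E v * star (sPath E l' w)) ∈ _
    by_cases hv : v = E.r e
    · subst hv
      rw [← mul_assoc, star_s_mul_p, ← star_mul]
      by_cases hw : w = E.r e
      · subst hw
        -- With nothing on the left to cancel, `s_e* s_ν*` is the adjoint of `s_ν s_e`: the edge is
        -- appended to the end of `ν`.
        have h := monomial_mem_pathSpan (E := E) (([], E.s e), (l' ++ [e], E.s e))
        rwa [monomial, sPath, ← star_p, ← star_mul, sPath_mul_p, ← sPath_mul_s] at h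
      · rw [sPath_mul_s_of_ne _ hw, star_zero]; exact zero_mem _
    · rw [← star_s_mul_p, mul_assoc, ← mul_assoc (p E _), p_mul_p_of_ne (Ne.symm hv), zero_mul,
        mul_zero]
      exact zero_mem _
  · change star (s E e) * (s E f * sPath E l v * star (sPath E l' w)) ∈ _
    rw [mul_assoc, ← mul_assoc]
    by_cases h : f = e
    · subst h
      rw [star_s_mul_s]
      exact p_mul_monomial_mem (E.s f) ((l, v), (l', w))
    · rw [star_s_mul_s_of_ne h, zero_mul]; exact zero_mem _

variable [Fintype V]

/-- The unit of the Toeplitz algebra. -/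
noncomputable def unit (E : DirectedGraph V Ed) : ToeplitzAlgebra E := ∑ v, p E v

theorem star_unit : star (unit E) = unit E := by
  rw [unit, star_sum]
  exact Finset.sum_congr rfl fun v _ => star_p v

theorem unit_mul_p (v : V) : unit E * p E v = p E v := by
  rw [unit, Finset.sum_mul, Finset.sum_eq_single v (fun w _ h => p_mul_p_of_ne h) (by simp),
    p_mul_p_self]

theorem p_mul_unit (v : V) : p E v * unit E = p E v := by
  rw [← star_p, ← star_unit, ← star_mul, unit_mul_p]

theorem unit_mul_and_mul_unit (a : ToeplitzAlgebra E) : unit E * a = a ∧ a * unit E = a := by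
  induction a using induction_on with
  | hC =>
    exact (isClosed_eq (continuous_const_mul _) continuous_id).inter
      (isClosed_eq (continuous_mul_const _) continuous_id)
  | hp v => exact ⟨unit_mul_p v, p_mul_unit v⟩
  | hs e =>
    refine ⟨?_, ?_⟩
    · rw [← p_mul_s, ← mul_assoc, unit_mul_p]
    · rw [← s_mul_p, mul_assoc, p_mul_unit]
  | hadd a b ha hb => exact ⟨by rw [mul_add, ha.1, hb.1], by rw [add_mul, ha.2, hb.2]⟩
  | hmul a b ha hb => exact ⟨by rw [← mul_assoc, ha.1], by rw [mul_assoc, hb.2]⟩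
  | hsmul z a ha => exact ⟨by rw [mul_smul_comm, ha.1], by rw [smul_mul_assoc, ha.2]⟩
  | hzero => exact ⟨mul_zero _, zero_mul _⟩
  | hstar a ha =>
    exact ⟨by rw [← star_unit, ← star_mul, ha.2], by rw [← star_unit, ← star_mul, ha.1]⟩

theorem unit_mul (a : ToeplitzAlgebra E) : unit E * a = a := (unit_mul_and_mul_unit a).1

theorem mul_unit (a : ToeplitzAlgebra E) : a * unit E = a := (unit_mul_and_mul_unit a).2

/-- Equality can fail: without vertices the unit is zero. -/
theorem norm_unit_le : ‖unit E‖ ≤ 1 :=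
  IsStarProjection.norm_le _ ⟨unit_mul _, star_unit⟩

/-- The closed span is stable under left multiplication by the generators and their adjoints, hence
is a left ideal; it contains the unit, because each `p_v` is a monomial. The induction treats `a`
and `star a` together so that it survives products and adjoints. -/
theorem mem_closure_pathSpan (a : ToeplitzAlgebra E) : a ∈ (pathSpan E).topologicalClosure := by
  have key : ∀ a : ToeplitzAlgebra E, ∀ b ∈ (pathSpan E).topologicalClosure,
      a * b ∈ (pathSpan E).topologicalClosure ∧ star a * b ∈ (pathSpan E).topologicalClosure := by
    intro a
    induction a using induction_on with
    | hC =>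
      simp only [Set.ofPred_forall]
      refine isClosed_iInter fun b => isClosed_iInter fun _ => ?_
      have hc := (pathSpan E).isClosed_topologicalClosure
      exact (hc.preimage (continuous_mul_const b)).inter
        (hc.preimage ((continuous_mul_const b).comp continuous_star))
    | hp v =>
      intro b hb
      rw [star_p, and_self]
      exact mul_mem_closure_pathSpan (p_mul_monomial_mem v) hb
    | hs e =>
      exact fun b hb => ⟨mul_mem_closure_pathSpan (s_mul_monomial_mem e) hb,
        mul_mem_closure_pathSpan (star_s_mul_monomial_mem e) hb⟩
    | hadd a a' ha ha' =>
      intro b hb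
      rw [star_add, add_mul, add_mul]
      exact ⟨add_mem (ha b hb).1 (ha' b hb).1, add_mem (ha b hb).2 (ha' b hb).2⟩
    | hmul a a' ha ha' =>
      intro b hb
      rw [star_mul, mul_assoc, mul_assoc]
      exact ⟨(ha _ (ha' b hb).1).1, (ha' _ (ha b hb).2).2⟩
    | hsmul z a ha =>
      intro b hb
      rw [star_smul, smul_mul_assoc, smul_mul_assoc]
      exact ⟨Submodule.smul_mem _ _ (ha b hb).1, Submodule.smul_mem _ _ (ha b hb).2⟩
    | hzero =>
      intro b hb
      rw [star_zero, zero_mul]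
      exact ⟨zero_mem _, zero_mem _⟩
    | hstar a ha =>
      intro b hb
      rw [star_star]
      exact (ha b hb).symm
  rw [← mul_unit a]
  refine (key a _ ?_).1
  refine sum_mem fun v _ => Submodule.le_topologicalClosure _ ?_
  have h := monomial_mem_pathSpan (E := E) (([], v), ([], v))
  rwa [monomial, sPath, star_p, p_mul_p_self] at h

/-- A closed linear property of elements holds if it holds for the elements `s_μ s_ν*`. -/
theorem induction_on_monomial {C : ToeplitzAlgebra E → Prop} (hC : IsClosed {a | C a})
    (hmon : ∀ x, C (monomial E x)) (hadd : ∀ a b, C a → C b → C (a + b))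
    (hsmul : ∀ (z : ℂ) a, C a → C (z • a)) (hzero : C 0) (a : ToeplitzAlgebra E) : C a := by
  have h : ∀ a ∈ pathSpan E, C a := fun a ha => by
    induction ha using Submodule.span_induction with
    | mem x hx => obtain ⟨x, rfl⟩ := hx; exact hmon x
    | zero => exact hzero
    | add x y _ _ hx hy => exact hadd x y hx hy
    | smul z x _ hx => exact hsmul z x hx
  exact closure_minimal (fun a ha => h a ha) hC (mem_closure_pathSpan a)

end Toeplitz

end PathSpan

/-! ### Functionals with the KMS relation on generators, and uniqueness -/

section GeneratorKMS

variable {V : Type u} {Ed : Type v} [Fintype Ed] [DecidableEq V]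

open Toeplitz

/-- At `β = 0` the path weight is the indicator of being a path, and the product over a list that is
not a path is zero. -/
theorem sPath_eq_zero_or_pathWeight_eq (E : DirectedGraph V Ed) (l : List Ed) (v : V) :
    sPath E l v = 0 ∨ pathWeight E 0 l v = 1 := by
  induction l with
  | nil => exact .inr rfl
  | cons e l ih =>
    rw [sPath, pathWeight]
    split_ifs with h
    · rcases ih with ih | ih
      · left; rw [ih, mul_zero]
      · right; simp [ih]
    · left
      rw [← s_mul_p, mul_assoc, p_mul_sPath_of_ne (Ne.symm h), mul_zero]

section

variable [Fintype V]

theorem pathWeight_le_weightedMatrix_pow (E : DirectedGraph V Ed) (β : ℝ) (l : List Ed) (v w : V)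
    (h : E.rng (l, w) = v) : pathWeight E β l w ≤ (weightedMatrix E β ^ l.length) v w := by
  rw [← sum_pathWeight_eq]
  have h1 := Finset.single_le_sum (f := fun l : Fin l.length → Ed =>
    if E.rng (List.ofFn l, w) = v then pathWeight E β (List.ofFn l) w else 0) (s := Finset.univ)
    (fun l _ => by
      split_ifs
      · exact pathWeight_nonneg _ _ _ _
      · exact le_rfl) (Finset.mem_univ l.get)
  rwa [List.ofFn_get, if_pos h] at h1

/-- Otherwise the diagonal entries of all powers `M^{kn}` would be at least one, while the terms of
a convergent series tend to zero. At `β = 0` this excludes closed paths of positive length. -/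
theorem weightedMatrix_pow_self_lt_one {E : DirectedGraph V Ed} {β : ℝ}
    (hs : Summable fun n => weightedMatrix E β ^ n) {k : ℕ}
    (hk : k ≠ 0) (v : V) : (weightedMatrix E β ^ k) v v < 1 := by
  by_contra! h
  have hn : ∀ n, 1 ≤ (weightedMatrix E β ^ (k * n)) v v := fun n => by
    induction n with
    | zero => simp
    | succ n ih =>
      rw [Nat.mul_succ, pow_add, Matrix.mul_apply]
      refine (one_le_mul_of_one_le_of_one_le ih h).trans ?_
      exact Finset.single_le_sum (f := fun u =>
        (weightedMatrix E β ^ (k * n)) v u * (weightedMatrix E β ^ k) u v)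
        (fun u _ => mul_nonneg (weightedMatrix_pow_nonneg _ _ _ _ _)
          (weightedMatrix_pow_nonneg _ _ _ _ _)) (Finset.mem_univ v)
  have h0 := (hasSum_resolventMatrix_inv hs v v).summable.tendsto_atTop_zero.comp
    (Filter.tendsto_id.const_mul_atTop' (Nat.pos_of_ne_zero hk))
  exact absurd (ge_of_tendsto' h0 hn) (by norm_num)

end

/-- A hermitian functional that satisfies the KMS condition at inverse temperature `β` for the
pairs whose first element is a generator. -/
structure IsGeneratorKMS (E : DirectedGraph V Ed) (β : ℝ) (φ : WeakDual ℂ (ToeplitzAlgebra E)) :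
    Prop where
  map_p_mul : ∀ v b, φ (p E v * b) = φ (b * p E v)
  map_s_mul : ∀ e b, φ (s E e * b) = Real.exp (-β) * φ (b * s E e)
  map_star : ∀ b, φ (star b) = star (φ b)

namespace IsGeneratorKMS

variable {E : DirectedGraph V Ed} {β : ℝ} {φ ψ : WeakDual ℂ (ToeplitzAlgebra E)}

theorem map_mul_star_s (hφ : IsGeneratorKMS E β φ) (e : Ed) (b : ToeplitzAlgebra E) :
    φ (b * star (s E e)) = Real.exp (-β) * φ (star (s E e) * b) := by
  have h := congrArg star (hφ.map_s_mul e (star b))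
  rw [star_mul', ← hφ.map_star, ← hφ.map_star, star_mul, star_mul, star_star] at h
  rw [h, RCLike.star_def, Complex.conj_ofReal]

theorem map_sPath_mul (hφ : IsGeneratorKMS E β φ) (l : List Ed) (v : V) (b : ToeplitzAlgebra E) :
    φ (sPath E l v * b) = (Real.exp (-β) : ℂ) ^ l.length * φ (b * sPath E l v) := by
  induction l generalizing b with
  | nil => simpa [sPath] using hφ.map_p_mul v b
  | cons e l ih =>
    rw [sPath, mul_assoc, hφ.map_s_mul, mul_assoc, ih, List.length_cons, pow_succ', mul_assoc,
      mul_assoc]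

variable [Fintype V]

/-- For `β ≠ 0`, commuting `s_μ` past the unit gives `φ(s_μ) = e^{-β|μ|} φ(s_μ)` with a factor
different from one. For `β = 0` that is empty, but then the graph has no closed paths, so a nonzero
`s_μ` has different range and source; commuting the range projection to the right gives zero. -/
theorem map_sPath_of_ne_nil (hφ : IsGeneratorKMS E β φ)
    (hs : Summable fun n => weightedMatrix E β ^ n) {l : List Ed} (hl : l ≠ []) (v : V) :
    φ (sPath E l v) = 0 := by
  have hl' : l.length ≠ 0 := by simpa using hl
  by_cases hβ : β = 0
  · subst hβ
    rcases sPath_eq_zero_or_pathWeight_eq E l v with h | h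
    · rw [h, map_zero]
    · by_cases hv : v = E.rng (l, v)
      · have h1 := pathWeight_le_weightedMatrix_pow E 0 l v v hv.symm
        rw [h] at h1
        exact absurd (weightedMatrix_pow_self_lt_one hs hl' v) (not_lt.2 h1)
      · rw [← p_rng_mul_sPath, hφ.map_p_mul, sPath_mul_p_of_ne _ hv, map_zero]
  · have h := hφ.map_sPath_mul l v (unit E)
    rw [mul_unit, unit_mul] at h
    have h2 : (Real.exp (-β) : ℂ) ^ l.length ≠ 1 := by
      rw [← Complex.ofReal_pow, ← Real.exp_nat_mul]
      norm_cast
      rw [Real.exp_eq_one_iff]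
      simp [hβ, hl]
    have h3 : ((Real.exp (-β) : ℂ) ^ l.length - 1) * φ (sPath E l v) = 0 := by
      rw [sub_mul, ← h, one_mul, sub_self]
    exact (mul_eq_zero.1 h3).resolve_left (sub_ne_zero.2 h2)

theorem map_sPath_mul_p_eq (hφ : IsGeneratorKMS E β φ) (hψ : IsGeneratorKMS E β ψ)
    (hs : Summable fun n => weightedMatrix E β ^ n) (h : ∀ v, φ (p E v) = ψ (p E v))
    (l : List Ed) (v w : V) : φ (sPath E l v * p E w) = ψ (sPath E l v * p E w) := by
  by_cases hw : v = w
  · subst hw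
    rw [sPath_mul_p]
    cases l with
    | nil => exact h v
    | cons e l =>
      rw [hφ.map_sPath_of_ne_nil hs (List.cons_ne_nil e l),
        hψ.map_sPath_of_ne_nil hs (List.cons_ne_nil e l)]
  · rw [sPath_mul_p_of_ne l hw, map_zero, map_zero]

/-- Carrying the adjoint of the first edge of `ν` around to the left meets the first edge of `μ`:
either they cancel to a projection and both lists become shorter, or the product is zero. When one
list is exhausted, the value is that of a single path or of its adjoint. -/
theorem map_monomial_eq (hφ : IsGeneratorKMS E β φ) (hψ : IsGeneratorKMS E β ψ)
    (hs : Summable fun n => weightedMatrix E β ^ n) (h : ∀ v, φ (p E v) = ψ (p E v))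
    (l l' : List Ed) (v w : V) :
    φ (sPath E l v * star (sPath E l' w)) = ψ (sPath E l v * star (sPath E l' w)) := by
  induction l generalizing l' with
  | nil =>
    have h1 := congrArg star (map_sPath_mul_p_eq hφ hψ hs h l' w v)
    rwa [← hφ.map_star, ← hψ.map_star, star_mul, star_p] at h1
  | cons e l ih =>
    cases l' with
    | nil =>
      rw [sPath, sPath, star_p, ← sPath]
      exact map_sPath_mul_p_eq hφ hψ hs h (e :: l) v w
    | cons f l' =>
      rw [sPath, sPath, star_mul, ← mul_assoc, hφ.map_mul_star_s, hψ.map_mul_star_s, ← mul_assoc,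
        ← mul_assoc]
      by_cases hef : e = f
      · subst hef
        rw [star_s_mul_s]
        by_cases hr : E.s e = E.rng (l, v)
        · rw [hr, p_rng_mul_sPath, ih]
        · rw [p_mul_sPath_of_ne hr, zero_mul, map_zero, map_zero]
      · rw [star_s_mul_s_of_ne hef, zero_mul, zero_mul, map_zero, map_zero]

/-- A functional that satisfies the KMS condition is determined by its values at the vertex
projections. -/
theorem ext (hφ : IsGeneratorKMS E β φ) (hψ : IsGeneratorKMS E β ψ)
    (hs : Summable fun n => weightedMatrix E β ^ n) (h : ∀ v, φ (p E v) = ψ (p E v)) :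
    φ = ψ := by
  refine DFunLike.ext _ _ fun a => ?_
  induction a using induction_on_monomial with
  | hC => exact isClosed_eq (map_continuous φ) (map_continuous ψ)
  | hmon x => exact map_monomial_eq hφ hψ hs h _ _ _ _
  | hadd a b ha hb => rw [map_add, map_add, ha, hb]
  | hsmul z a ha => rw [map_smul, map_smul, ha]
  | hzero => rw [map_zero, map_zero]

end IsGeneratorKMS

end GeneratorKMS

/-! ### From generators to analytic elements and back -/

section KMS

variable {V : Type u} {Ed : Type v} [Fintype Ed] [DecidableEq V]

open Toeplitz

variable {E : DirectedGraph V Ed} {β : ℝ} {φ : WeakDual ℂ (ToeplitzAlgebra E)}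

theorem dynamics_p (E : DirectedGraph V Ed) (t : ℝ) (v : V) : dynamics E t (p E v) = p E v :=
  gauge_p _ _

theorem dynamics_s (E : DirectedGraph V Ed) (t : ℝ) (e : Ed) :
    dynamics E t (s E e) = Complex.exp (t * Complex.I) • s E e := gauge_s _ _

theorem dynamics_sPath (E : DirectedGraph V Ed) (t : ℝ) (l : List Ed) (v : V) :
    dynamics E t (sPath E l v) = Complex.exp (t * Complex.I) ^ l.length • sPath E l v := by
  induction l with
  | nil => simp [sPath, dynamics_p]
  | cons e l ih =>
    rw [sPath, map_mul, ih, dynamics_s, smul_mul_smul_comm, List.length_cons, pow_succ']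

/-- The degree of `s_μ s_ν*`. -/
def monomialDegree (x : (List Ed × V) × (List Ed × V)) : ℤ := x.1.1.length - x.2.1.length

theorem dynamics_monomial (E : DirectedGraph V Ed) (t : ℝ) (x : (List Ed × V) × (List Ed × V)) :
    dynamics E t (monomial E x)
      = Complex.exp (monomialDegree x * (t * Complex.I)) • monomial E x := by
  have h : star (Complex.exp (t * Complex.I)) = Complex.exp (-(t * Complex.I)) := by
    rw [RCLike.star_def, ← Complex.exp_conj]; simp
  rw [monomial, map_mul, map_star, dynamics_sPath, dynamics_sPath, star_smul, smul_mul_smul_comm,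
    star_pow, h, ← Complex.exp_nat_mul, ← Complex.exp_nat_mul, ← Complex.exp_add, monomialDegree]
  push_cast
  ring_nf

theorem isAnalyticOrbit_of_homogeneous {a : ToeplitzAlgebra E} {k : ℤ}
    (h : ∀ t : ℝ, dynamics E t a = Complex.exp (k * (t * Complex.I)) • a) :
    IsAnalyticOrbit (dynamics E) a fun z => Complex.exp (k * (z * Complex.I)) • a := by
  refine ⟨?_, fun t => (h t).symm⟩
  have h1 : Differentiable ℂ fun z : ℂ => Complex.exp (k * (z * Complex.I)) := by fun_prop
  exact h1.smul_const a

theorem homogeneous_p (E : DirectedGraph V Ed) (v : V) (t : ℝ) :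
    dynamics E t (p E v) = Complex.exp ((0 : ℤ) * (t * Complex.I)) • p E v := by
  simp [dynamics_p]

theorem homogeneous_s (E : DirectedGraph V Ed) (e : Ed) (t : ℝ) :
    dynamics E t (s E e) = Complex.exp ((1 : ℤ) * (t * Complex.I)) • s E e := by
  simp [dynamics_s]

/-- A homogeneous element has the explicit orbit `e^{ikz} a`, whose value at `iβ` is `e^{-kβ} a`.
The KMS condition applies when `b` is a monomial, also analytic, and extends to every `b` by
density. -/
theorem map_mul_of_isKMSState (hφ : IsKMSState (dynamics E) β φ) [Fintype V]
    {a : ToeplitzAlgebra E} {k : ℤ}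
    (ha : ∀ t : ℝ, dynamics E t a = Complex.exp (k * (t * Complex.I)) • a)
    (b : ToeplitzAlgebra E) : φ (a * b) = Complex.exp (-(k * β)) * φ (b * a) := by
  induction b using induction_on_monomial with
  | hC =>
    exact isClosed_eq ((map_continuous φ).comp (continuous_const_mul a))
      (continuous_const.mul ((map_continuous φ).comp (continuous_mul_const a)))
  | hmon x =>
    rw [hφ.2 a (monomial E x) _ _ (isAnalyticOrbit_of_homogeneous ha)
      (isAnalyticOrbit_of_homogeneous fun t => dynamics_monomial E t x), mul_smul_comm, map_smul,
      smul_eq_mul]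
    congr 2
    linear_combination (k : ℂ) * β * Complex.I_mul_I
  | hadd b c hb hc => rw [mul_add, add_mul, map_add, map_add, hb, hc, mul_add]
  | hsmul z b hb =>
    rw [mul_smul_comm, smul_mul_assoc, map_smul, map_smul, hb, smul_eq_mul, smul_eq_mul,
      mul_left_comm]
  | hzero => rw [mul_zero, zero_mul, map_zero, mul_zero]

/-- Polarization against the unit: the values at `b* b` are real for `b = 1 + a` and `b = 1 + i a`,
which fixes the imaginary and the real part of `φ(a*)`. -/
theorem map_star_of_map_star_mul_self_nonneg [Fintype V] (hφ : ∀ b, 0 ≤ φ (star b * b))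
    (a : ToeplitzAlgebra E) : φ (star a) = star (φ a) := by
  have him : ∀ b, (φ (star b * b)).im = 0 := fun b => (Complex.nonneg_iff.1 (hφ b)).2.symm
  have h0 := him (unit E)
  have h1 := him a
  have h2 := him (unit E + a)
  have h3 := him (unit E + Complex.I • a)
  simp only [star_add, star_smul, add_mul, mul_add, star_unit, unit_mul, mul_unit, map_add,
    map_smul, smul_mul_assoc, mul_smul_comm, smul_eq_mul, Complex.add_im] at h0 h1 h2 h3
  simp at h3
  rw [h1] at h2 h3
  rw [h0] at h2 h3
  apply Complex.ext
  · rw [RCLike.star_def, Complex.conj_re]; linarith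
  · rw [RCLike.star_def, Complex.conj_im]; linarith

theorem isGeneratorKMS_of_isKMSState [Fintype V] (hφ : IsKMSState (dynamics E) β φ) :
    IsGeneratorKMS E β φ where
  map_p_mul v b := by
    rw [map_mul_of_isKMSState hφ (homogeneous_p E v)]; simp
  map_s_mul e b := by
    rw [map_mul_of_isKMSState hφ (homogeneous_s E e)]; simp
  map_star := map_star_of_map_star_mul_self_nonneg hφ.1.1

/-- The elements `b` of degree `k` with `φ (a b) = e^{kβ} φ (b a)` for all `a`. -/
structure IsKMSElement (φ : WeakDual ℂ (ToeplitzAlgebra E)) (β : ℝ) (b : ToeplitzAlgebra E)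
    (k : ℤ) : Prop where
  homogeneous : ∀ t : ℝ, dynamics E t b = Complex.exp (k * (t * Complex.I)) • b
  map_mul : ∀ a, φ (a * b) = Complex.exp (k * β) * φ (b * a)

theorem IsGeneratorKMS.isKMSElement_sPath (hφ : IsGeneratorKMS E β φ) (l : List Ed) (v : V) :
    IsKMSElement φ β (sPath E l v) l.length where
  homogeneous t := by
    rw [dynamics_sPath, ← Complex.exp_nat_mul]; simp
  map_mul a := by
    rw [hφ.map_sPath_mul, ← mul_assoc, Complex.ofReal_exp, ← Complex.exp_nat_mul,
      ← Complex.exp_add]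
    simp

/-- First `s_ν*` and then `s_μ` is moved to the left, with factors `e^{-|ν|β}` and `e^{|μ|β}`; the
rule for `s_ν*` is the adjoint of the one for `s_ν`. -/
theorem IsGeneratorKMS.isKMSElement_monomial (hφ : IsGeneratorKMS E β φ)
    (x : (List Ed × V) × (List Ed × V)) :
    IsKMSElement φ β (monomial E x) (monomialDegree x) where
  homogeneous t := dynamics_monomial E t x
  map_mul a := by
    have h : ∀ b, φ (b * star (sPath E x.2.1 x.2.2)) = Complex.exp (-(x.2.1.length * β))
        * φ (star (sPath E x.2.1 x.2.2) * b) := fun b => by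
      have h1 := congrArg star ((hφ.isKMSElement_sPath x.2.1 x.2.2).map_mul (star b))
      rw [star_mul', ← hφ.map_star, ← hφ.map_star, star_mul, star_mul, star_star, RCLike.star_def,
        ← Complex.exp_conj] at h1
      rw [h1, ← mul_assoc, ← Complex.exp_add]
      simp
    rw [monomial, ← mul_assoc, h, ← mul_assoc, (hφ.isKMSElement_sPath x.1.1 x.1.2).map_mul,
      ← mul_assoc, ← Complex.exp_add, ← mul_assoc, monomialDegree]
    push_cast
    ring_nf

/-- The entire functions `φ(b f(z))` and `e^{-ikz} φ(b a)` agree on the real line by invariance,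
hence also at `iβ`, where the second is `e^{kβ} φ(b a) = φ(a b)`. -/
theorem IsKMSElement.map_mul_analytic {b : ToeplitzAlgebra E} {k : ℤ}
    (hb : IsKMSElement φ β b k) (hinv : ∀ (t : ℝ) a, φ (dynamics E t a) = φ a)
    {a : ToeplitzAlgebra E} {f : ℂ → ToeplitzAlgebra E} (hf : IsAnalyticOrbit (dynamics E) a f) :
    φ (a * b) = φ (b * f (β * Complex.I)) := by
  have hF : Differentiable ℂ fun z => φ (b * f z) :=
    (((WeakDual.toStrongDual φ).comp
      (ContinuousLinearMap.mul ℂ (ToeplitzAlgebra E) b)).differentiable).comp hf.1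
  have hG : Differentiable ℂ fun z : ℂ => Complex.exp (-(k * (z * Complex.I))) * φ (b * a) := by
    fun_prop
  have hreal : ∀ t : ℝ, φ (b * f t) = Complex.exp (-(k * (t * Complex.I))) * φ (b * a) := by
    intro t
    have h1 : dynamics E t ((Complex.exp (-(k * (t * Complex.I))) • b) * a) = b * f t := by
      rw [_root_.map_mul, map_smul, hb.homogeneous, smul_smul, ← Complex.exp_add, hf.2]
      simp
    rw [← h1, hinv, smul_mul_assoc, map_smul, smul_eq_mul]
  have heq := AnalyticOnNhd.eq_of_frequently_eq (z₀ := 0)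
    (hF.differentiableOn.analyticOnNhd isOpen_univ) (hG.differentiableOn.analyticOnNhd isOpen_univ)
    ?_
  · rw [hb.map_mul, congrFun heq (β * Complex.I)]
    congr 2
    linear_combination (k : ℂ) * β * Complex.I_mul_I
  -- The identity theorem needs agreement only on a set accumulating at `0`; the real points `1 / (n
  -- + 1)` suffice.
  · have h0 : Filter.Tendsto (fun n : ℕ => ((1 / ((n : ℝ) + 1) : ℝ) : ℂ)) Filter.atTop
        (nhdsWithin 0 {0}ᶜ) := by
      refine tendsto_nhdsWithin_iff.2 ⟨?_, .of_forall fun n => ?_⟩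
      · have := (Complex.continuous_ofReal.tendsto 0).comp tendsto_one_div_add_atTop_nhds_zero_nat
        simpa [Function.comp_def] using this
      · simp only [Set.mem_compl_iff, Set.mem_singleton_iff, Complex.ofReal_eq_zero]
        positivity
    exact h0.frequently (.of_forall fun n => hreal _)

theorem IsGeneratorKMS.isKMSState [Fintype V] (hφ : IsGeneratorKMS E β φ)
    (hinv : ∀ (t : ℝ) a, φ (dynamics E t a) = φ a) (hstate : IsState φ) :
    IsKMSState (dynamics E) β φ := by
  refine ⟨hstate, ?_⟩
  -- Analyticity of `b` is dropped: for fixed `a` and `f` both sides are continuous and linear in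
  -- `b`, so monomials suffice.
  rintro a b f - hf -
  induction b using induction_on_monomial with
  | hC =>
    exact isClosed_eq ((map_continuous φ).comp (continuous_const_mul a))
      ((map_continuous φ).comp (continuous_mul_const _))
  | hmon x => exact (hφ.isKMSElement_monomial x).map_mul_analytic hinv hf
  | hadd b c hb hc => rw [mul_add, add_mul, map_add, map_add, hb, hc]
  | hsmul z b hb => rw [mul_smul_comm, smul_mul_assoc, map_smul, map_smul, hb]
  | hzero => rw [mul_zero, zero_mul]

end KMS

/-! ### The map `ε ↦ φ_ε` and its inverse -/

section KMSSimplex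

variable {V : Type u} {Ed : Type v} [Fintype V] [Fintype Ed] [DecidableEq V]

open Toeplitz

/-- The functional on the Toeplitz algebra given by the weights of the paths with source `w`. -/
noncomputable def kmsFunctional (E : DirectedGraph V Ed) (β : ℝ) (w : V) :
    WeakDual ℂ (ToeplitzAlgebra E) :=
  StrongDual.toWeakDual ((fockFunctional E β w).comp
    ((fockHom E : ToeplitzAlgebra E →ₗ[ℂ] _).mkContinuous 1 fun a => by
      rw [one_mul]; exact NonUnitalStarAlgHom.norm_apply_le (fockHom E) a))

/-- The linear extension of the map `ε ↦ φ_ε`. -/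
noncomputable def kmsMap (E : DirectedGraph V Ed) (β : ℝ) :
    (V → ℝ) →ₗ[ℝ] WeakDual ℂ (ToeplitzAlgebra E) :=
  Fintype.linearCombination ℝ (kmsFunctional E β)

theorem kmsMap_apply (E : DirectedGraph V Ed) (β : ℝ) (ε : V → ℝ) (a : ToeplitzAlgebra E) :
    kmsMap E β ε a = ∑ w, (ε w : ℂ) * fockFunctional E β w (fockHom E a) := by
  rw [kmsMap, Fintype.linearCombination_apply]
  have h : ∀ s : Finset V, (∑ w ∈ s, ε w • kmsFunctional E β w) a
      = ∑ w ∈ s, (ε w : ℂ) * fockFunctional E β w (fockHom E a) := fun s => by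
    classical
    induction s using Finset.induction_on with
    | empty => rfl
    | insert w s hw ih =>
      rw [Finset.sum_insert hw, Finset.sum_insert hw, ← ih]
      rfl
  exact h _

variable {E : DirectedGraph V Ed} {β : ℝ}

theorem kmsMap_p (hs : Summable fun n => weightedMatrix E β ^ n) (ε : V → ℝ) (v : V) :
    kmsMap E β ε (p E v) = (((resolventMatrix E β)⁻¹.mulVec ε v : ℝ) : ℂ) := by
  simp only [kmsMap_apply, fockHom_p, fockFunctional_vertexProj hs, Matrix.mulVec, dotProduct]
  push_cast
  exact Finset.sum_congr rfl fun w _ => mul_comm _ _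

theorem kmsMap_unit (hs : Summable fun n => weightedMatrix E β ^ n) (ε : V → ℝ) :
    kmsMap E β ε (unit E) = ((∑ v, ε v * yVec E β v : ℝ) : ℂ) := by
  rw [unit, map_sum]
  simp only [kmsMap_p hs, yVec_eq hs, Matrix.mulVec, dotProduct, Finset.mul_sum]
  rw [← Complex.ofReal_sum, Finset.sum_comm]
  simp only [mul_comm]

theorem kmsMap_star_mul_self_nonneg (hs : Summable fun n => weightedMatrix E β ^ n) {ε : V → ℝ}
    (hε : ∀ v, 0 ≤ ε v) (b : ToeplitzAlgebra E) : 0 ≤ kmsMap E β ε (star b * b) := by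
  rw [kmsMap_apply]
  refine Finset.sum_nonneg fun w _ => mul_nonneg (Complex.zero_le_real.2 (hε w)) ?_
  rw [map_mul, map_star]
  exact fockFunctional_star_mul_self_nonneg hs w _

theorem kmsMap_dynamics (hs : Summable fun n => weightedMatrix E β ^ n) (ε : V → ℝ) (t : ℝ)
    (a : ToeplitzAlgebra E) : kmsMap E β ε (dynamics E t a) = kmsMap E β ε a := by
  rw [kmsMap_apply, kmsMap_apply]
  refine Finset.sum_congr rfl fun w _ => ?_
  congr 1
  refine (hasSum_fockFunctional hs w _).unique ?_
  refine Eq.mp (congrArg (fun f => HasSum f _) (funext fun l => ?_))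
    (hasSum_fockFunctional hs w (fockHom E a))
  rw [dynamics, inner_ket_fockHom_gauge]

theorem isGeneratorKMS_kmsMap (hs : Summable fun n => weightedMatrix E β ^ n) {ε : V → ℝ}
    (hε : ∀ v, 0 ≤ ε v) : IsGeneratorKMS E β (kmsMap E β ε) where
  map_p_mul v b := by
    simp only [kmsMap_apply, map_mul, fockHom_p, fockFunctional_suppProj_mul hs]
  map_s_mul e b := by
    simp only [kmsMap_apply, map_mul, fockHom_s, fockFunctional_creation_mul hs, Finset.mul_sum]
    exact Finset.sum_congr rfl fun w _ => mul_left_comm _ _ _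
  map_star := map_star_of_map_star_mul_self_nonneg (kmsMap_star_mul_self_nonneg hs hε)

/-- The upper bound is the total weight of the vector functionals; the value at the unit attains it.
-/
theorem norm_kmsMap (hs : Summable fun n => weightedMatrix E β ^ n) {ε : V → ℝ}
    (hε : ∀ v, 0 ≤ ε v) :
    ‖WeakDual.toStrongDual (kmsMap E β ε)‖ = ∑ v, ε v * yVec E β v := by
  have hpos : 0 ≤ ∑ v, ε v * yVec E β v :=
    Finset.sum_nonneg fun v _ => mul_nonneg (hε v) (yVec_pos hs v).le
  refine le_antisymm (ContinuousLinearMap.opNorm_le_bound _ hpos fun a => ?_) ?_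
  · change ‖kmsMap E β ε a‖ ≤ _
    rw [kmsMap_apply, Finset.sum_mul]
    refine norm_sum_le_of_le _ fun w _ => ?_
    rw [norm_mul, Complex.norm_real, Real.norm_of_nonneg (hε w), mul_assoc]
    refine mul_le_mul_of_nonneg_left ?_ (hε w)
    refine ((fockFunctional E β w).le_opNorm _).trans ?_
    exact mul_le_mul (norm_fockFunctional_le hs w)
      (NonUnitalStarAlgHom.norm_apply_le (fockHom E) a) (norm_nonneg _) (yVec_pos hs w).le
  · have h := (WeakDual.toStrongDual (kmsMap E β ε)).le_opNorm (unit E)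
    change ‖kmsMap E β ε (unit E)‖ ≤ _ at h
    rw [kmsMap_unit hs, Complex.norm_real, Real.norm_of_nonneg hpos] at h
    exact h.trans (mul_le_of_le_one_right (norm_nonneg _) norm_unit_le)

theorem kmsMap_mem_kmsStates (hs : Summable fun n => weightedMatrix E β ^ n) {ε : V → ℝ}
    (hε : ε ∈ deltaSimplex E β) : kmsMap E β ε ∈ kmsStates E β :=
  (isGeneratorKMS_kmsMap hs hε.1).isKMSState (kmsMap_dynamics hs ε)
    ⟨kmsMap_star_mul_self_nonneg hs hε.1, (norm_kmsMap hs hε.1).trans hε.2⟩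

/-- The vector `(1 - e^{-β} A) (φ (p v))`. -/
noncomputable def kmsVector (E : DirectedGraph V Ed) (β : ℝ) (φ : WeakDual ℂ (ToeplitzAlgebra E)) :
    V → ℝ :=
  (resolventMatrix E β).mulVec fun v => (φ (p E v)).re

/-- This holds for every real vector, not only on `Δ_β`, so `kmsMap` is injective as a linear map.
-/
theorem kmsVector_kmsMap (hs : Summable fun n => weightedMatrix E β ^ n) (ε : V → ℝ) :
    kmsVector E β (kmsMap E β ε) = ε := by
  have h := (Matrix.isUnit_iff_isUnit_det _).1 (isUnit_resolventMatrix hs)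
  simp only [kmsVector, kmsMap_p hs, Complex.ofReal_re]
  rw [Matrix.mulVec_mulVec, Matrix.mul_nonsing_inv _ h, Matrix.one_mulVec]

theorem kmsVector_apply (E : DirectedGraph V Ed) (β : ℝ) (φ : WeakDual ℂ (ToeplitzAlgebra E))
    (v : V) : kmsVector E β φ v = (φ (p E v)).re
      - ∑ e, if E.r e = v then Real.exp (-β) * (φ (p E (E.s e))).re else 0 := by
  rw [kmsVector, show resolventMatrix E β = 1 - weightedMatrix E β from rfl, Matrix.sub_mulVec, Matrix.one_mulVec, Pi.sub_apply]
  congr 1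
  have h := fun w => weightedMatrix_pow_succ_apply E β 0 v w
  simp only [zero_add, pow_one, pow_zero] at h
  simp only [Matrix.mulVec, dotProduct, h, Finset.sum_mul]
  rw [Finset.sum_comm]
  refine Finset.sum_congr rfl fun e _ => ?_
  by_cases hv : E.r e = v
  · simp [hv, Matrix.one_apply]
  · simp [hv]

/-- Since `φ(s_e s_e*) = e^{-β} φ(p_{s(e)})`, this component is the value of `φ` at the positive
element `p_v - ∑ s_e s_e*`. -/
theorem kmsVector_nonneg {φ : WeakDual ℂ (ToeplitzAlgebra E)} (hφ : IsGeneratorKMS E β φ)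
    (hpos : ∀ b, 0 ≤ φ (star b * b)) (v : V) : 0 ≤ kmsVector E β φ v := by
  obtain ⟨c, hc⟩ := (universalFamily E).sum_le v
  have h := (Complex.nonneg_iff.1 (hpos c)).1
  rw [← hc, map_sub, map_sum, Complex.sub_re, Complex.re_sum] at h
  rw [kmsVector_apply, ← Finset.sum_filter]
  refine h.trans_eq (congrArg₂ _ rfl (Finset.sum_congr rfl fun e _ => ?_))
  change (φ (s E e * star (s E e))).re = _
  rw [hφ.map_s_mul, star_s_mul_s, Complex.re_ofReal_mul]

theorem kmsMap_kmsVector (hs : Summable fun n => weightedMatrix E β ^ n)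
    {φ : WeakDual ℂ (ToeplitzAlgebra E)} (hφ : φ ∈ kmsStates E β) :
    kmsMap E β (kmsVector E β φ) = φ := by
  have h1 := isGeneratorKMS_of_isKMSState hφ
  refine (isGeneratorKMS_kmsMap hs (kmsVector_nonneg h1 hφ.1.1)).ext h1 hs fun v => ?_
  have h := (Matrix.isUnit_iff_isUnit_det _).1 (isUnit_resolventMatrix hs)
  rw [kmsMap_p hs, kmsVector, Matrix.mulVec_mulVec, Matrix.nonsing_inv_mul _ h, Matrix.one_mulVec]
  have h2 := congrArg Complex.im (h1.map_star (p E v))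
  rw [star_p, RCLike.star_def, Complex.conj_im] at h2
  exact Complex.ext (Complex.ofReal_re _) (by rw [Complex.ofReal_im]; linarith)

/-- The normalization is the norm formula read backwards: `φ` has norm one and equals `kmsMap` of
this nonnegative vector. -/
theorem kmsVector_mem_deltaSimplex (hs : Summable fun n => weightedMatrix E β ^ n)
    {φ : WeakDual ℂ (ToeplitzAlgebra E)} (hφ : φ ∈ kmsStates E β) :
    kmsVector E β φ ∈ deltaSimplex E β := by
  have h0 := kmsVector_nonneg (isGeneratorKMS_of_isKMSState hφ) hφ.1.1
  refine ⟨h0, ?_⟩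
  rw [← norm_kmsMap hs h0, kmsMap_kmsVector hs hφ]
  exact hφ.1.2

theorem kmsStates_eq_image (hs : Summable fun n => weightedMatrix E β ^ n) :
    kmsStates E β = kmsMap E β '' deltaSimplex E β :=
  Set.Subset.antisymm
    (fun φ hφ => ⟨kmsVector E β φ, kmsVector_mem_deltaSimplex hs hφ, kmsMap_kmsVector hs hφ⟩)
    (by rintro _ ⟨ε, hε, rfl⟩; exact kmsMap_mem_kmsStates hs hε)

theorem isSimplexOn_deltaSimplex (hs : Summable fun n => weightedMatrix E β ^ n) :
    IsSimplexOn V (deltaSimplex E β) :=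
  ⟨_, (linearIndependent_deltaVertex hs).affineIndependent, deltaSimplex_eq_convexHull hs⟩

theorem isSimplexOn_kmsStates (hs : Summable fun n => weightedMatrix E β ^ n) :
    IsSimplexOn V (kmsStates E β) := by
  have hinj : Function.Injective (kmsMap E β) :=
    Function.LeftInverse.injective (kmsVector_kmsMap hs)
  refine ⟨_, ((linearIndependent_deltaVertex hs).map' (kmsMap E β)
    (LinearMap.ker_eq_bot.2 hinj)).affineIndependent, ?_⟩
  rw [kmsStates_eq_image hs, deltaSimplex_eq_convexHull hs, LinearMap.image_convexHull,
    ← Set.range_comp]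

theorem continuous_kmsMap (E : DirectedGraph V Ed) (β : ℝ) : Continuous (kmsMap E β) := by
  refine WeakDual.continuous_of_continuous_eval fun a => ?_
  simp only [kmsMap_apply]
  fun_prop

theorem continuous_kmsVector (E : DirectedGraph V Ed) (β : ℝ) : Continuous (kmsVector E β) := by
  have h : ∀ v, Continuous fun φ : WeakDual ℂ (ToeplitzAlgebra E) => (φ (p E v)).re :=
    fun v => Complex.continuous_re.comp (WeakDual.eval_continuous (p E v))
  exact continuous_const.matrix_mulVec (continuous_pi h)

/-- The homeomorphism `ε ↦ φ_ε`. -/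
noncomputable def kmsHomeomorph (hs : Summable fun n => weightedMatrix E β ^ n) :
    deltaSimplex E β ≃ₜ kmsStates E β where
  toFun ε := ⟨kmsMap E β ε, kmsMap_mem_kmsStates hs ε.2⟩
  invFun φ := ⟨kmsVector E β φ, kmsVector_mem_deltaSimplex hs φ.2⟩
  left_inv ε := Subtype.ext (kmsVector_kmsMap hs ε)
  right_inv φ := Subtype.ext (kmsMap_kmsVector hs φ.2)
  continuous_toFun := ((continuous_kmsMap E β).comp continuous_subtype_val).subtype_mk _
  continuous_invFun := ((continuous_kmsVector E β).comp continuous_subtype_val).subtype_mk _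

end KMSSimplex

theorem theorem2 {V : Type u} {Ed : Type v} [Fintype V] [Fintype Ed] [DecidableEq V]
    (E : DirectedGraph V Ed) (β : ℝ) (hβ : ENNReal.log E.rho < (β : EReal)) :
    IsUnit (resolventMatrix E β) ∧
    (∀ v, Summable (yTerm E β v)) ∧
    IsSimplexOn V (deltaSimplex E β) ∧
    IsSimplexOn V (kmsStates E β) ∧
    ∃ Φ : deltaSimplex E β ≃ₜ kmsStates E β,
      (∀ (ε : deltaSimplex E β) (v : V),
        (Φ ε : WeakDual ℂ (ToeplitzAlgebra E)) (Toeplitz.p E v)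
          = ((resolventMatrix E β)⁻¹.mulVec (ε : V → ℝ) v : ℝ)) ∧
      ∀ (ε₀ ε₁ ε : deltaSimplex E β) (t : ℝ), t ∈ Set.Icc (0 : ℝ) 1 →
        (ε : V → ℝ) = (1 - t) • (ε₀ : V → ℝ) + t • (ε₁ : V → ℝ) →
        (Φ ε : WeakDual ℂ (ToeplitzAlgebra E))
          = (1 - t) • (Φ ε₀ : WeakDual ℂ (ToeplitzAlgebra E))
            + t • (Φ ε₁ : WeakDual ℂ (ToeplitzAlgebra E)) := by
  have hs := summable_weightedMatrix_pow E hβ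
  refine ⟨isUnit_resolventMatrix hs, fun v => (hasSum_yTerm hs v).summable,
    isSimplexOn_deltaSimplex hs, isSimplexOn_kmsStates hs, kmsHomeomorph hs,
    fun ε v => kmsMap_p hs ε v, fun ε₀ ε₁ ε t _ h => ?_⟩
  change kmsMap E β ε = (1 - t) • kmsMap E β ε₀ + t • kmsMap E β ε₁
  rw [h, map_add, map_smul, map_smul]
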